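/- **Setting.** The one-particle Hilbert space is used in its mode representation: a radial field $C(r)=\frac1{\sqrt2}\int_0^\infty c(w)J_0(wr)\,\mathrm dw$ is identified with its mode function $c\in\mathcal H=L^2((0,\infty),\mathrm dw)$, with $\langle C_1,C_2\rangle=\int_0^\infty\overline{c_1(w)}c_2(w)\,\mathrm dw$. The $n$-particle space $\mathcal H^{\otimes_s n}$ is the space of symmetric functions in $L^2((0,\infty)^n)$, $C^{\otimes n}=\prod_{j=1}^n c(w_j)$ and $C^{\otimes0}=1$. The free Hamiltonian $H_0=\mathrm d\Gamma(\sqrt\Theta)$, where $\sqrt\Theta$ is multiplication by $w$, acts on $\mathcal H^{\otimes_s n}$ as multiplication by $w_1+\dots+w_n$, and $f(H_0)$ acts as multiplication by $f(w_1+\dots+w_n)$. Put $E(x)=2-2e^{-x/2}$, $h_0(C)=\int_0^\infty w|c(w)|^2\,\mathrm dw$, $\varrho(C)=(h_0(C)+2)e^{-h_0(C)/2}-2$, and $$A_n(t)=\big\langle C^{\otimes n}\,\big|\,\exp\!\big(it(e^{-h_0(C)/2}H_0-E(H_0))\big)C^{\otimes n}\big\rangle,\qquad P_C(t,N)=e^{-\|C\|^2}\sum_{n=0}^N\frac1{n!}A_n(t).$$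 For $n\ge1$ let $$G_n(z,C)=\int |c(z-w_1-\dots-w_{n-1})|^2\prod_{k=1}^{n-1}|c(w_k)|^2\,\mathrm dw_1\cdots\mathrm dw_{n-1},$$ integrated over $0\le w_k<z-\sum_{j<k}w_j$ for $k=1,\dots,n-1$ (so $G_1(z,C)=|c(z)|^2$). **Statement.** Let $c$ be twice continuously differentiable on $[0,\infty)$, with $c,c',c''\in L^2(0,\infty)$ and $h_0(C)<\infty$. Then: 1. The phase $\varphi(z)=e^{-h_0(C)/2}z-E(z)$ has exactly one stationary point, $z=h_0(C)$; it satisfies $h_0(C)>0$ if $C\neq0$; and $\varphi(h_0(C))=\varrho(C)$. 2. For every $n\ge1$, $G_n(\cdot,C)$ is integrable on $(0,\infty)$, $A_n(t)=\int_0^\infty e^{it\varphi(z)}G_n(z,C)\,\mathrm dz$ for all real $t$, and, as $t\to\infty$, $$A_n(t)=\sqrt{4\pi}\,e^{h_0(C)/4}\,G_n(h_0(C),C)\,e^{i\pi/4}\,\frac{e^{it\varrho(C)}}{\sqrt t}+O(1/t).$$ 3. For every $N\in\mathbb N$, as $t\to\infty$, $$P_C(t,N)=e^{-\|C\|^2}+\frac{e^{it\varrho(C)}}{\sqrt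 t}\,F(C,N)+O(1/t),\qquad F(C,N)=e^{-\|C\|^2}\sum_{n=1}^N\frac1{n!}\sqrt{4\pi}\,e^{h_0(C)/4}\,G_n(h_0(C),C)\,e^{i\pi/4}.$$ -/

import Mathlib

open MeasureTheory Set Filter Asymptotics

noncomputable section

namespace EinsteinRosen

/-! ## One-particle space (mode representation) -/

/-- Lebesgue measure `dw` on the half line `(0, ∞)` of mode frequencies. -/
abbrev halfLine : Measure ℝ := volume.restrict (Ioi 0)

/-- The one-particle Hilbert space in its mode representation: the radial field
`C(r) = (1/√2) ∫₀^∞ c(w) J₀(w r) dw` is identified with its mode function `c`. The scalar product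
is `⟨C₁, C₂⟩ = ∫₀^∞ conj (c₁ w) * c₂ w dw`, and `√Θ = √(-Δ)` is multiplication by `w`. -/
abbrev OneParticle : Type := Lp ℂ 2 halfLine

/-- The free Hamiltonian `h₀(C) = ⟨C, √Θ C⟩ = ∫₀^∞ w |c(w)|² dw`. -/
def freeEnergy (C : OneParticle) : ℝ := ∫ w in Ioi 0, w * ‖C w‖ ^ 2

/-- The function `E(x) = 2 - 2 exp(-x/2)` that relates the physical and the free Hamiltonian. -/
def energyFunction (x : ℝ) : ℝ := 2 - 2 * Real.exp (-x / 2)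

/-! ## The `n`-particle spaces -/

/-- The product measure `dw₁ ⋯ dwₙ` on `(0, ∞)ⁿ`. -/
abbrev modeMeasure (n : ℕ) : Measure (Fin n → ℝ) := Measure.pi fun _ => halfLine

/-- The Hilbert tensor power of `n` copies of the one-particle space, realised as
`L²((0, ∞)ⁿ, dw₁ ⋯ dwₙ)`. For `n = 0` the measure is a unit point mass and the space is `ℂ`. -/
abbrev TensorSpace (n : ℕ) : Type := Lp ℂ 2 (modeMeasure n)

theorem measurePreserving_perm {n : ℕ} (σ : Equiv.Perm (Fin n)) :
    MeasurePreserving (fun w : Fin n → ℝ => w ∘ σ) (modeMeasure n) (modeMeasure n) := by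
  have h := measurePreserving_piCongrLeft (fun _ : Fin n => halfLine) σ.symm
  convert h using 1
  ext w i
  have := MeasurableEquiv.piCongrLeft_apply_apply (β := fun _ : Fin n => ℝ) σ.symm w (σ i)
  simpa using this.symm

/-- The symmetrised tensor power: the square-integrable functions of `w₁, …, wₙ` that are invariant
under all permutations of the variables. -/
def NParticle (n : ℕ) : Submodule ℂ (TensorSpace n) :=
  ⨅ σ : Equiv.Perm (Fin n),
    LinearMap.eqLocus (Lp.compMeasurePreservingₗ ℂ _ (measurePreserving_perm σ)) LinearMap.id

theorem mem_NParticle_iff {n : ℕ} (ψ : TensorSpace n) :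
    ψ ∈ NParticle n ↔
      ∀ σ : Equiv.Perm (Fin n), (fun w => ψ (w ∘ σ)) =ᵐ[modeMeasure n] ψ := by
  simp only [NParticle, Submodule.mem_iInf, LinearMap.mem_eqLocus, LinearMap.id_apply]
  refine forall_congr' fun σ => ?_
  have h := Lp.coeFn_compMeasurePreserving ψ (measurePreserving_perm σ)
  change Lp.compMeasurePreserving _ (measurePreserving_perm σ) ψ = ψ ↔ _
  rw [Lp.ext_iff]
  exact ⟨fun h' => h.symm.trans h', fun h' => h.trans h'⟩

theorem memLp_tensorPower (C : OneParticle) (n : ℕ) :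
    MemLp (fun w : Fin n → ℝ => ∏ j, C (w j)) 2 (modeMeasure n) := by
  have hm : AEStronglyMeasurable (fun w : Fin n → ℝ => ∏ j, C (w j)) (modeMeasure n) :=
    Finset.aestronglyMeasurable_fun_prod _ fun j _ =>
      (Lp.aestronglyMeasurable C).comp_quasiMeasurePreserving
        (Measure.quasiMeasurePreserving_eval (fun _ : Fin n => halfLine) j)
  rw [memLp_two_iff_integrable_sq_norm hm]
  have h1 : Integrable (fun w => ‖C w‖ ^ 2) halfLine :=
    (memLp_two_iff_integrable_sq_norm (Lp.aestronglyMeasurable C)).1 (Lp.memLp C)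
  have h2 := Integrable.fintype_prod (ι := Fin n) (f := fun _ w => ‖C w‖ ^ 2)
    (μ := fun _ => halfLine) (fun _ => h1)
  simpa [Finset.prod_pow] using h2

/-- The vector `C^{⊗n}`, i.e. the function `∏ⱼ c(wⱼ)`, as an element of the symmetrised tensor
power; `C^{⊗0} = 1`. -/
def tensorPower (C : OneParticle) (n : ℕ) : NParticle n :=
  ⟨(memLp_tensorPower C n).toLp, by
    rw [mem_NParticle_iff]
    intro σ
    have h := (memLp_tensorPower C n).coeFn_toLp
    refine ((measurePreserving_perm σ).quasiMeasurePreserving.ae_eq_comp h).trans ?_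
    refine Filter.EventuallyEq.trans (Filter.EventuallyEq.of_eq ?_) h.symm
    ext w
    exact Equiv.prod_comp σ fun j => C (w j)⟩

/-! ## Functions of the free quantum Hamiltonian -/

/-- The maximal domain of `f(H₀)` on the `n`-particle space. -/
def functionDomain (n : ℕ) (f : ℝ → ℂ) : Submodule ℂ (NParticle n) where
  carrier := {ψ | MemLp (fun w => f (∑ j, w j) * (ψ : TensorSpace n) w) 2 (modeMeasure n)}
  zero_mem' := by
    have h : (fun _ => 0 : (Fin n → ℝ) → ℂ) =ᵐ[modeMeasure n]
        fun w => f (∑ j, w j) * ((0 : NParticle n) : TensorSpace n) w := by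
      filter_upwards [Lp.coeFn_zero ℂ 2 (modeMeasure n)] with w hw
      exact ((congrArg (f (∑ j, w j) * ·) hw).trans (mul_zero _)).symm
    exact (memLp_congr_ae h).1 MemLp.zero
  add_mem' := by
    intro ψ φ hψ hφ
    refine (memLp_congr_ae ?_).1 (MemLp.add hψ hφ)
    filter_upwards [Lp.coeFn_add (ψ : TensorSpace n) (φ : TensorSpace n)] with w hw
    exact ((congrArg (f (∑ j, w j) * ·) hw).trans (mul_add _ _ _)).symm
  smul_mem' := by
    intro a ψ hψ
    refine (memLp_congr_ae ?_).1 (MemLp.const_smul hψ a)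
    filter_upwards [Lp.coeFn_smul a (ψ : TensorSpace n)] with w hw
    exact ((congrArg (f (∑ j, w j) * ·) hw).trans (mul_left_comm _ _ _)).symm

theorem memLp_of_mem_functionDomain {n : ℕ} {f : ℝ → ℂ} (ψ : functionDomain n f) :
    MemLp (fun w => f (∑ j, w j) * ((ψ : NParticle n) : TensorSpace n) w) 2 (modeMeasure n) :=
  ψ.2

/-- The operator `f(H₀)` on the `n`-particle space, with its maximal domain. The free Hamiltonian
`H₀ = dΓ(√Θ)` acts on the `n`-particle space as `∑ⱼ I ⊗ ⋯ ⊗ √Θ ⊗ ⋯ ⊗ I`, that is as multiplication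
by `w₁ + ⋯ + wₙ` (this is the case `f x = x`); a Borel function `f` of this self-adjoint operator is
multiplication by `f(w₁ + ⋯ + wₙ)`. -/
def functionOfH0 (n : ℕ) (f : ℝ → ℂ) : NParticle n →ₗ.[ℂ] NParticle n where
  domain := functionDomain n f
  toFun :=
    { toFun := fun ψ => ⟨(memLp_of_mem_functionDomain ψ).toLp, by
        rw [mem_NParticle_iff]
        intro σ
        have h := (memLp_of_mem_functionDomain ψ).coeFn_toLp
        have h' := (mem_NParticle_iff _).1 ψ.1.2 σ
        refine ((measurePreserving_perm σ).quasiMeasurePreserving.ae_eq_comp h).trans ?_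
        filter_upwards [h, h'] with w hw hw'
        have hs : ∑ j, w (σ j) = ∑ j, w j := Equiv.sum_comp σ w
        simp only [Function.comp_apply] at hw' ⊢
        rw [hw, hs]
        exact congrArg _ hw'⟩
      map_add' := by
        intro ψ φ
        apply Subtype.ext
        apply Lp.ext
        refine (memLp_of_mem_functionDomain (ψ + φ)).coeFn_toLp.trans ?_
        filter_upwards [Lp.coeFn_add (memLp_of_mem_functionDomain ψ).toLp
            (memLp_of_mem_functionDomain φ).toLp,
          (memLp_of_mem_functionDomain ψ).coeFn_toLp, (memLp_of_mem_functionDomain φ).coeFn_toLp,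
          Lp.coeFn_add (ψ.1 : TensorSpace n) (φ.1 : TensorSpace n)] with w h1 h2 h3 h4
        refine Eq.trans ?_ h1.symm
        rw [Pi.add_apply, h2, h3, ← mul_add]
        exact congrArg (f (∑ j, w j) * ·) h4
      map_smul' := by
        intro a ψ
        apply Subtype.ext
        apply Lp.ext
        refine (memLp_of_mem_functionDomain (a • ψ)).coeFn_toLp.trans ?_
        filter_upwards [Lp.coeFn_smul a (memLp_of_mem_functionDomain ψ).toLp,
          (memLp_of_mem_functionDomain ψ).coeFn_toLp,
          Lp.coeFn_smul a (ψ.1 : TensorSpace n)] with w h1 h2 h4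
        refine Eq.trans ?_ h1.symm
        rw [Pi.smul_apply, h2, smul_eq_mul, mul_left_comm]
        exact congrArg (f (∑ j, w j) * ·) h4 }

/-- The phase `z ↦ e^{-h₀(C)/2} z - E(z)`. -/
def phase (C : OneParticle) (z : ℝ) : ℝ :=
  Real.exp (-freeEnergy C / 2) * z - energyFunction z

/-- The function `x ↦ exp(i t (e^{-h₀(C)/2} x - E(x)))`, to be applied to `H₀`. -/
def evolutionSymbol (C : OneParticle) (t x : ℝ) : ℂ :=
  Complex.exp (Complex.I * (t * phase C x : ℝ))

theorem mem_domain_evolution (C : OneParticle) (t : ℝ) (n : ℕ) (ψ : NParticle n) :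
    ψ ∈ (functionOfH0 n (evolutionSymbol C t)).domain := by
  change MemLp (fun w => evolutionSymbol C t (∑ j, w j) * (ψ : TensorSpace n) w) 2 (modeMeasure n)
  have hm : Measurable fun w : Fin n → ℝ => evolutionSymbol C t (∑ j, w j) := by
    unfold evolutionSymbol phase energyFunction
    fun_prop
  refine MemLp.of_le (Lp.memLp (ψ : TensorSpace n))
    (hm.aestronglyMeasurable.mul (Lp.aestronglyMeasurable _)) (Filter.Eventually.of_forall ?_)
  intro w
  rw [norm_mul, evolutionSymbol, Complex.norm_exp_I_mul_ofReal, one_mul]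

/-- The unitary operator `exp(i t (e^{-h₀(C)/2} H₀ - E(H₀)))` on the `n`-particle space. -/
def evolution (C : OneParticle) (t : ℝ) (n : ℕ) (ψ : NParticle n) : NParticle n :=
  functionOfH0 n (evolutionSymbol C t) ⟨ψ, mem_domain_evolution C t n ψ⟩

/-- The matrix element `⟨C^{⊗n} | exp(i t (e^{-h₀(C)/2} H₀ - E(H₀))) C^{⊗n}⟩`. -/
def matrixElement (C : OneParticle) (n : ℕ) (t : ℝ) : ℂ :=
  inner ℂ (tensorPower C n) (evolution C t n (tensorPower C n))

/-- The truncated projection `P_C(t, N)` of the evolved coherent state on the coherent state of the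
classically evolved data. -/
def truncatedProjection (C : OneParticle) (N : ℕ) (t : ℝ) : ℂ :=
  (Real.exp (-‖C‖ ^ 2) : ℂ) *
    ∑ n ∈ Finset.range (N + 1), (1 / (n.factorial : ℂ)) * matrixElement C n t

/-! ## The data of the expansion -/

/-- `ϱ(C) = (h₀(C) + 2) e^{-h₀(C)/2} - 2`. -/
def varrho (C : OneParticle) : ℝ :=
  (freeEnergy C + 2) * Real.exp (-freeEnergy C / 2) - 2

/-- The function `G_n(z, C)` for `n ≥ 1` and a mode function `c` of `C`: the integral of
`|c(z - ∑ⱼ wⱼ)|² ∏ₖ |c(wₖ)|²` over the `n - 1` variables `wₖ ∈ [0, z - ∑_{j<k} wⱼ)`.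
In particular `G_1(z, C) = |c(z)|²`. -/
def energyDensity (c : ℝ → ℂ) (n : ℕ) (z : ℝ) : ℝ :=
  ∫ w in {w : Fin (n - 1) → ℝ | ∀ k, 0 ≤ w k ∧ w k < z - ∑ j ∈ Finset.Iio k, w j},
    ‖c (z - ∑ j, w j)‖ ^ 2 * ∏ k, ‖c (w k)‖ ^ 2

/-- The coefficient `√(4π) e^{h₀(C)/4} G_n(h₀(C), C) e^{iπ/4}` of the `n`-particle term. -/
def stationaryCoefficient (C : OneParticle) (c : ℝ → ℂ) (n : ℕ) : ℂ :=
  (Real.sqrt (4 * Real.pi) * Real.exp (freeEnergy C / 4) * energyDensity c n (freeEnergy C) : ℝ) *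
    Complex.exp (Complex.I * (Real.pi / 4 : ℝ))

/-- The factor `F(C, N)`. -/
def amplitude (C : OneParticle) (c : ℝ → ℂ) (N : ℕ) : ℂ :=
  (Real.exp (-‖C‖ ^ 2) : ℂ) *
    ∑ n ∈ Finset.Icc 1 N, (1 / (n.factorial : ℂ)) * stationaryCoefficient C c n

/-- Regularity of a mode function: `c` is twice continuously differentiable on `[0, ∞)`
(one-sided at `0`), `c`, `c'` and `c''` are square integrable on `(0, ∞)`, and the free energy
`∫₀^∞ w |c(w)|² dw` is finite. -/
structure RegularModes (c : ℝ → ℂ) : Prop where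
  contDiffOn : ContDiffOn ℝ 2 c (Ici 0)
  memLp : ∀ k ≤ 2, MemLp (iteratedDerivWithin k c (Ici 0)) 2 halfLine
  energy : IntegrableOn (fun w => w * ‖c w‖ ^ 2) (Ioi 0)

end EinsteinRosen

end

open Topology

/-! ## Parametric integrals of smooth functions -/

/-! The evolution multiplies by a unimodular function of `w₁ + ⋯ + wₙ`, so the matrix element is the
integral of `exp(itφ(∑ wⱼ))` against `∏ |c(wⱼ)|²`. Pushing this density forward under the sum gives
the `n`-fold half-line convolution of `|c|²`, which is `G_n` (`integral_prod_smul_sum_eq`,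
`energyDensity_succ`). Everything thus reduces to a one-dimensional oscillatory integral over `(0,
∞)`. Its phase is convex, with `φ'(z) = e^{-h/2} - e^{-z/2}` and `φ''(z) = e^{-z/2}/2`, where `h =
h₀(C)`, and `h` is its only critical point.

For `C ≠ 0` the point `h` is interior, and the integral is split at `h + 1`. On `(0, h + 1)`, write
`φ = φ(h) + S²` and `G = α S' + φ' q` with `q` of class C¹. The first term becomes a Fresnel
integral in `u = S(z)` and gives the `t^{-1/2}` term; the second is O(1/t) by one integration by
parts, as is the endpoint contribution (`exists_norm_stationaryPhase_sub_le`). On the tail `φ'` is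
bounded below, and integration by parts needs only `G` and `G'` integrable
(`exists_norm_integral_Ioi_oscillation_le`).

These properties of `G` propagate through convolutions because `(f * F)' = F(0) f + f * F'`
(`SmoothDensity.halfLineConv`). To avoid one-sided derivatives at `0`, `c` is first replaced by a C²
extension to the line. -/

theorem hasDerivAt_intervalIntegral_of_contDiff {E : Type*} [NormedAddCommGroup E]
    [NormedSpace ℝ E] {f : ℝ → ℝ → E} (a b : ℝ)
    (hf : ContDiff ℝ 1 (Function.uncurry f)) (x : ℝ) :
    HasDerivAt (fun x => ∫ θ in a..b, f x θ)
      (∫ θ in a..b, fderiv ℝ (Function.uncurry f) (x, θ) (1, 0)) x := by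
  have hd : Continuous fun p : ℝ × ℝ => fderiv ℝ (Function.uncurry f) p (1, 0) :=
    (hf.continuous_fderiv one_ne_zero).clm_apply continuous_const
  -- The continuous partial derivative is bounded on a compact box, so a constant serves as
  -- dominating function.
  obtain ⟨M, hM⟩ := ((isCompact_Icc (a := x - 1) (b := x + 1)).prod
    (isCompact_uIcc (a := a) (b := b))).exists_bound_of_continuousOn hd.continuousOn
  have hc : ∀ y, Continuous (f y) := fun y => hf.continuous.comp (by fun_prop : Continuous fun θ => (y, θ))
  refine (intervalIntegral.hasDerivAt_integral_of_dominated_loc_of_deriv_le (μ := volume)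
    (F := f) (F' := fun y θ => fderiv ℝ (Function.uncurry f) (y, θ) (1, 0))
    (bound := fun _ => M) (s := Icc (x - 1) (x + 1))
    (Icc_mem_nhds (by linarith) (by linarith)) ?_ ?_ ?_ ?_ ?_ ?_).2
  · exact Eventually.of_forall fun y => (hc y).aestronglyMeasurable
  · exact (hc x).intervalIntegrable _ _
  · exact (hd.comp (by fun_prop : Continuous fun θ => (x, θ))).aestronglyMeasurable
  · exact Eventually.of_forall fun θ hθ y hy => hM (y, θ) ⟨hy, uIoc_subset_uIcc hθ⟩
  · exact intervalIntegrable_const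
  · refine Eventually.of_forall fun θ _ y _ => ?_
    have h1 := (hf.differentiable one_ne_zero (y, θ)).hasFDerivAt
    exact h1.comp_hasDerivAt y ((hasDerivAt_id y).prodMk (hasDerivAt_const y θ))

/-- By induction: the derivative is an integral of the same kind, with an integrand of one order
less. -/
theorem contDiff_intervalIntegral {E : Type*} [NormedAddCommGroup E]
    [NormedSpace ℝ E] (a b : ℝ) (n : ℕ) {f : ℝ → ℝ → E}
    (hf : ContDiff ℝ n (Function.uncurry f)) :
    ContDiff ℝ n fun x => ∫ θ in a..b, f x θ := by
  induction n generalizing f with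
  | zero =>
    rw [Nat.cast_zero, contDiff_zero] at hf ⊢
    exact intervalIntegral.continuous_parametric_intervalIntegral_of_continuous' hf a b
  | succ n ih =>
    have h1 : ContDiff ℝ 1 (Function.uncurry f) := hf.of_le (by norm_cast; omega)
    have hd := hasDerivAt_intervalIntegral_of_contDiff a b h1
    push_cast
    rw [contDiff_succ_iff_deriv]
    refine ⟨fun x => (hd x).differentiableAt, by simp, ?_⟩
    rw [show deriv (fun x => ∫ θ in a..b, f x θ) = fun x => ∫ θ in a..b,
      fderiv ℝ (Function.uncurry f) (x, θ) (1, 0) from funext fun x => (hd x).deriv]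
    refine ih ?_
    have h2 : ContDiff ℝ n (fderiv ℝ (Function.uncurry f)) := hf.fderiv_right (by norm_cast)
    exact h2.clm_apply contDiff_const

/-! ## The Fresnel integral -/

/-- The tail of a Gaussian integral, bounded uniformly up to the imaginary axis. -/
theorem norm_integral_Ioi_gaussian_le {b : ℂ} (hb : 0 < b.re) {B : ℝ} (hB : 0 < B) :
    ‖∫ u in Ioi B, Complex.exp (-b * u ^ 2)‖ ≤ 1 / (‖b‖ * B) := by
  have hb0 : b ≠ 0 := by rintro rfl; simp at hb
  have hnb : 0 < ‖b‖ := norm_pos_iff.2 hb0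
  have hn : ∀ u : ℝ, ‖Complex.exp (-b * u ^ 2)‖ ≤ 1 := by
    intro u
    rw [Complex.norm_exp, Real.exp_le_one_iff]
    have : (-b * (u : ℂ) ^ 2).re = -b.re * u ^ 2 := by
      rw [← Complex.ofReal_pow, Complex.re_mul_ofReal]; simp
    rw [this]
    nlinarith [sq_nonneg u]
  have hgi : IntegrableOn (fun u : ℝ => Complex.exp (-b * u ^ 2)) (Ioi B) :=
    (integrable_cexp_neg_mul_sq hb).integrableOn
  have hpow : IntegrableOn (fun u : ℝ => 1 / (2 * ‖b‖) * u ^ (-2 : ℝ)) (Ioi B) :=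
    (integrableOn_Ioi_rpow_of_lt (by norm_num) hB).const_mul _
  have hbd : ∀ u ∈ Ioi B, ‖Complex.exp (-b * u ^ 2) / (2 * b * u ^ 2)‖ ≤
      1 / (2 * ‖b‖) * u ^ (-2 : ℝ) := by
    intro u hu
    have hu0 : 0 < u := hB.trans hu
    rw [norm_div, norm_mul, norm_mul, norm_pow, Complex.norm_real, Real.norm_of_nonneg hu0.le,
      Real.rpow_neg hu0.le, Real.rpow_two, Complex.norm_ofNat, ← one_div, div_mul_div_comm, one_mul]
    gcongr
    exact hn u
  have hri : IntegrableOn (fun u : ℝ => Complex.exp (-b * u ^ 2) / (2 * b * u ^ 2)) (Ioi B) := by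
    refine hpow.mono' ?_ ((ae_restrict_mem measurableSet_Ioi).mono hbd)
    exact Measurable.aestronglyMeasurable (by fun_prop)
  -- Integration by parts: this function is an antiderivative of the Gaussian up to a remainder of
  -- size `u⁻²`. The boundary term and the remainder each cost at most `1 / (2‖b‖B)`, and `b.re`
  -- enters only through its sign.
  have hder : ∀ u ∈ Ici B, HasDerivAt (fun u : ℝ => Complex.exp (-b * u ^ 2) / (-2 * b * u))
      (Complex.exp (-b * u ^ 2) + Complex.exp (-b * u ^ 2) / (2 * b * u ^ 2)) u := by
    intro u hu
    have hu0 : (u : ℂ) ≠ 0 := by exact_mod_cast (hB.trans_le hu).ne'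
    have h1 : HasDerivAt (fun z : ℂ => Complex.exp (-b * z ^ 2) / (-2 * b * z))
        (Complex.exp (-b * u ^ 2) + Complex.exp (-b * u ^ 2) / (2 * b * u ^ 2)) (u : ℂ) := by
      have h2 := ((((hasDerivAt_id (u : ℂ)).pow 2).const_mul (-b)).cexp).div
        ((hasDerivAt_id (u : ℂ)).const_mul (-2 * b)) (by simpa [hb0] using hu0)
      refine h2.congr_deriv ?_
      simp only [id, Pi.pow_apply]
      field_simp
      ring
    exact h1.comp_ofReal
  have hlim : Tendsto (fun u : ℝ => Complex.exp (-b * u ^ 2) / (-2 * b * u)) atTop (𝓝 0) := by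
    rw [tendsto_zero_iff_norm_tendsto_zero]
    have h1 : Tendsto (fun u : ℝ => 1 / (2 * ‖b‖) * u⁻¹) atTop (𝓝 0) := by
      simpa using tendsto_inv_atTop_zero.const_mul (1 / (2 * ‖b‖))
    refine squeeze_zero' (Eventually.of_forall fun _ => norm_nonneg _) ?_ h1
    filter_upwards [eventually_gt_atTop 0] with u hu
    rw [norm_div, norm_mul, norm_mul, norm_neg, Complex.norm_real, Real.norm_of_nonneg hu.le,
      Complex.norm_ofNat, ← one_div, div_mul_div_comm, one_mul]
    gcongr
    exact hn u
  have hftc := integral_Ioi_of_hasDerivAt_of_tendsto' hder (hgi.add hri) hlim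
  rw [integral_add hgi hri] at hftc
  have h3 : ‖∫ u in Ioi B, Complex.exp (-b * u ^ 2) / (2 * b * u ^ 2)‖ ≤ 1 / (2 * ‖b‖) * B⁻¹ := by
    refine (norm_integral_le_of_norm_le hpow ((ae_restrict_mem measurableSet_Ioi).mono hbd)).trans ?_
    rw [integral_const_mul, integral_Ioi_rpow_of_lt (by norm_num) hB]
    norm_num
    rw [Real.rpow_neg hB.le, Real.rpow_one]
  have h4 : ‖Complex.exp (-b * B ^ 2) / (-2 * b * B)‖ ≤ 1 / (2 * ‖b‖) * B⁻¹ := by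
    rw [norm_div, norm_mul, norm_mul, norm_neg, Complex.norm_real, Real.norm_of_nonneg hB.le,
      Complex.norm_ofNat, ← one_div, div_mul_div_comm, one_mul]
    gcongr
    exact hn B
  rw [eq_sub_of_add_eq hftc]
  calc _ ≤ _ + _ := norm_sub_le _ _
    _ ≤ 1 / (2 * ‖b‖) * B⁻¹ + 1 / (2 * ‖b‖) * B⁻¹ := by
        rw [zero_sub, norm_neg]; exact add_le_add h4 h3
    _ = _ := by field_simp; norm_num

/-- Regularise by `b = ε - it`. For `ε > 0` the half-line Gaussian integral is explicit and the tail
beyond `B` is at most `1/(tB)`, since `‖b‖ ≥ t`. This bound is uniform in `ε`, so it survives `ε →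
0`. -/
theorem norm_fresnel_sub_le {t : ℝ} (ht : 0 < t) {B : ℝ} (hB : 0 < B) :
    ‖(∫ u in (0 : ℝ)..B, Complex.exp (Complex.I * (t * u ^ 2 : ℝ))) -
      Real.sqrt (Real.pi / t) * Complex.exp (Complex.I * (Real.pi / 4 : ℝ)) / 2‖ ≤ 1 / (t * B) := by
  set b : ℝ → ℂ := fun ε => ε - Complex.I * t with hbdef
  have hbre : ∀ ε, (b ε).re = ε := fun ε => by simp [b]
  have hbim : ∀ ε, (b ε).im = -t := fun ε => by simp [b]
  have hbt : ∀ ε, t ≤ ‖b ε‖ := fun ε => by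
    have := Complex.abs_im_le_norm (b ε)
    rwa [hbim, abs_neg, abs_of_pos ht] at this
  have hbc : Continuous b := by fun_prop
  have key : ∀ ε, 0 < ε → ‖(∫ u in (0 : ℝ)..B, Complex.exp (-b ε * u ^ 2)) -
      (Real.pi / b ε) ^ (1 / 2 : ℂ) / 2‖ ≤ 1 / (t * B) := by
    intro ε hε
    have hre : 0 < (b ε).re := by rw [hbre]; exact hε
    have hgi := integrable_cexp_neg_mul_sq hre
    rw [← integral_gaussian_complex_Ioi hre,
      ← intervalIntegral.integral_interval_add_Ioi hgi.integrableOn hgi.integrableOn (b := B),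
      sub_add_cancel_left, norm_neg]
    refine (norm_integral_Ioi_gaussian_le hre hB).trans ?_
    gcongr
    exact hbt ε
  have h1 : Tendsto (fun ε => ∫ u in (0 : ℝ)..B, Complex.exp (-b ε * u ^ 2)) (𝓝[>] 0)
      (𝓝 (∫ u in (0 : ℝ)..B, Complex.exp (-b 0 * u ^ 2))) := by
    have : Continuous fun ε => ∫ u in (0 : ℝ)..B, Complex.exp (-b ε * u ^ 2) :=
      intervalIntegral.continuous_parametric_intervalIntegral_of_continuous'
        (f := fun ε u => Complex.exp (-b ε * (u : ℂ) ^ 2))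
        (by unfold Function.uncurry; fun_prop) 0 B
    exact (this.tendsto 0).mono_left nhdsWithin_le_nhds
  have hb0 : Real.pi / b 0 = (Real.pi / t : ℝ) * Complex.I := by
    have : (t : ℂ) ≠ 0 := by exact_mod_cast ht.ne'
    simp only [b, Complex.ofReal_zero, zero_sub]
    push_cast
    field_simp
    simp
  -- The limit `iπ/t` is off the branch cut, so the principal square root is continuous there; its
  -- argument is `π/4`.
  have hsl : Real.pi / b 0 ∈ Complex.slitPlane := by
    rw [hb0, Complex.mem_slitPlane_iff]
    right
    simp [Real.pi_ne_zero, ht.ne']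
  have hb0' : b 0 ≠ 0 := fun h => ht.ne' (by simpa [h] using hbim 0)
  have h2 : Tendsto (fun ε => (Real.pi / b ε) ^ (1 / 2 : ℂ) / 2) (𝓝[>] 0)
      (𝓝 ((Real.pi / b 0) ^ (1 / 2 : ℂ) / 2)) := by
    have : ContinuousAt (fun ε => (Real.pi / b ε) ^ (1 / 2 : ℂ) / 2) 0 :=
      ((continuousAt_const.div hbc.continuousAt hb0').cpow continuousAt_const hsl).div_const 2
    exact this.tendsto.mono_left nhdsWithin_le_nhds
  have h3 := le_of_tendsto (h1.sub h2).norm (eventually_mem_nhdsWithin.mono key)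
  have h4 : (Real.pi / b 0) ^ (1 / 2 : ℂ) =
      Real.sqrt (Real.pi / t) * Complex.exp (Complex.I * (Real.pi / 4 : ℝ)) := by
    have hpt : 0 < Real.pi / t := div_pos Real.pi_pos ht
    rw [hb0, Complex.cpow_def_of_ne_zero (hb0 ▸ Complex.slitPlane_ne_zero hsl),
      Complex.log_ofReal_mul hpt Complex.I_ne_zero, Complex.log_I, Real.sqrt_eq_rpow,
      Real.rpow_def_of_pos hpt, Complex.ofReal_exp, ← Complex.exp_add]
    congr 1
    push_cast
    ring
  rw [h4] at h3
  have h5 : ∀ u : ℝ, Complex.exp (-b 0 * u ^ 2) = Complex.exp (Complex.I * (t * u ^ 2 : ℝ)) := by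
    intro u
    simp only [b]
    push_cast
    ring_nf
  simpa only [h5] using h3

/-! ## Hadamard's lemma -/

/-- The fundamental theorem of calculus along the segment from `h` to `z`; it exhibits the
difference quotient as a parametric integral, hence as smooth across `z = h`. -/
theorem eq_add_mul_intervalIntegral_deriv {F F1 : ℝ → ℝ} (hF : ∀ z, HasDerivAt F (F1 z) z)
    (hF1 : Continuous F1) (h z : ℝ) :
    F z = F h + (z - h) * ∫ θ in (0 : ℝ)..1, F1 (h + θ * (z - h)) := by
  have hd : ∀ θ ∈ uIcc (0 : ℝ) 1, HasDerivAt (fun θ => F (h + θ * (z - h)))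
      ((z - h) * F1 (h + θ * (z - h))) θ := by
    intro θ _
    have h1 : HasDerivAt (fun θ => h + θ * (z - h)) (z - h) θ := by
      simpa using ((hasDerivAt_id θ).mul_const (z - h)).const_add h
    exact ((hF (h + θ * (z - h))).comp θ h1).congr_deriv (mul_comm _ _)
  have h2 := intervalIntegral.integral_eq_sub_of_hasDerivAt hd
    (Continuous.intervalIntegrable (by fun_prop) _ _)
  rw [intervalIntegral.integral_const_mul] at h2
  rw [h2]
  simp

theorem eq_taylor_two {F F1 F2 : ℝ → ℝ} (hF : ∀ z, HasDerivAt F (F1 z) z)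
    (hF1 : ∀ z, HasDerivAt F1 (F2 z) z) (hF2 : Continuous F2) (h z : ℝ) :
    F z = F h + (z - h) * F1 h +
      (z - h) ^ 2 * ∫ θ in (0 : ℝ)..1, (1 - θ) * F2 (h + θ * (z - h)) := by
  -- The two terms in `F1` cancel in the derivative of this combination, leaving the integral
  -- remainder.
  have hd : ∀ θ ∈ uIcc (0 : ℝ) 1, HasDerivAt
      (fun θ => F (h + θ * (z - h)) + (1 - θ) * F1 (h + θ * (z - h)) * (z - h))
      ((z - h) ^ 2 * ((1 - θ) * F2 (h + θ * (z - h)))) θ := by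
    intro θ _
    have h1 : HasDerivAt (fun θ => h + θ * (z - h)) (z - h) θ := by
      simpa using ((hasDerivAt_id θ).mul_const (z - h)).const_add h
    have h3 := ((hF (h + θ * (z - h))).comp θ h1).add
      ((((hasDerivAt_id θ).const_sub 1).mul
        ((hF1 (h + θ * (z - h))).comp θ h1)).mul_const (z - h))
    refine h3.congr_deriv ?_
    simp only [id, Function.comp]
    ring
  have h2 := intervalIntegral.integral_eq_sub_of_hasDerivAt hd
    (Continuous.intervalIntegrable (by fun_prop) _ _)
  rw [intervalIntegral.integral_const_mul] at h2
  rw [h2]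
  simp
  ring

theorem contDiff_intervalIntegral_weight {F w : ℝ → ℝ} {n : ℕ} (hF : ContDiff ℝ n F)
    (hw : ContDiff ℝ n w) (h : ℝ) :
    ContDiff ℝ n fun z => ∫ θ in (0 : ℝ)..1, w θ * F (h + θ * (z - h)) :=
  contDiff_intervalIntegral 0 1 n (f := fun z θ => w θ * F (h + θ * (z - h)))
    ((hw.comp contDiff_snd).mul (hF.comp (by fun_prop)))

/-! ## Oscillatory integrals -/

theorem hasDerivAt_oscillation {φ φ1 q q1 : ℝ → ℝ} {z : ℝ} (t : ℝ)
    (hφ : HasDerivAt φ (φ1 z) z) (hq : HasDerivAt q (q1 z) z) :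
    HasDerivAt (fun z => Complex.exp (Complex.I * (t * φ z : ℝ)) * q z)
      (Complex.I * t * (Complex.exp (Complex.I * (t * φ z : ℝ)) * (φ1 z * q z : ℝ)) +
        Complex.exp (Complex.I * (t * φ z : ℝ)) * q1 z) z := by
  have h1 := (((hφ.const_mul t).ofReal_comp).const_mul Complex.I).cexp.mul hq.ofReal_comp
  refine h1.congr_deriv ?_
  push_cast
  ring

/-- The factor `φ'` in the amplitude makes `e^{itφ} φ'` an exact derivative up to `it`. One
integration by parts gains `1/t` without dividing by `φ'`, which may vanish. -/
theorem exists_norm_intervalIntegral_oscillation_le {φ φ1 q : ℝ → ℝ}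
    (hφ : ∀ z, HasDerivAt φ (φ1 z) z) (hφ1 : Continuous φ1) (hq : ContDiff ℝ 1 q) (a b : ℝ) :
    ∃ M, ∀ t : ℝ, 0 < t →
      ‖∫ z in a..b, Complex.exp (Complex.I * (t * φ z : ℝ)) * (φ1 z * q z : ℝ)‖ ≤ M / t := by
  have hq1 : Continuous (deriv q) := hq.continuous_deriv le_rfl
  have hφc : Continuous φ := continuous_iff_continuousAt.2 fun z => (hφ z).continuousAt
  have hqd : ∀ z, HasDerivAt q (deriv q z) z := fun z =>
    (hq.differentiable one_ne_zero z).hasDerivAt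
  refine ⟨|q b| + |q a| + |∫ z in a..b, ‖deriv q z‖|, fun t ht => ?_⟩
  have hftc := intervalIntegral.integral_eq_sub_of_hasDerivAt
    (fun z (_ : z ∈ uIcc a b) => hasDerivAt_oscillation t (hφ z) (hqd z))
    (Continuous.intervalIntegrable (by have := hq.continuous; fun_prop) _ _)
  rw [intervalIntegral.integral_add
    (Continuous.intervalIntegrable (by have := hq.continuous; fun_prop) _ _)
    (Continuous.intervalIntegrable (by fun_prop) _ _), intervalIntegral.integral_const_mul] at hftc
  have h1 : ‖∫ z in a..b, Complex.exp (Complex.I * (t * φ z : ℝ)) * ((deriv q z : ℝ) : ℂ)‖ ≤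
      |∫ z in a..b, ‖deriv q z‖| := by
    refine (intervalIntegral.norm_integral_le_abs_integral_norm).trans (le_of_eq ?_)
    simp [Complex.norm_exp_I_mul_ofReal, -Complex.ofReal_mul]
  have h2 := congrArg norm (eq_sub_of_add_eq hftc)
  rw [norm_mul, norm_mul, Complex.norm_I, one_mul, Complex.norm_real, Real.norm_of_nonneg ht.le]
    at h2
  rw [le_div_iff₀ ht, mul_comm, h2]
  refine (norm_sub_le _ _).trans (add_le_add ((norm_sub_le _ _).trans (le_of_eq ?_)) h1)
  rw [norm_mul, norm_mul, Complex.norm_exp_I_mul_ofReal, Complex.norm_exp_I_mul_ofReal,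
    one_mul, one_mul, Complex.norm_real, Complex.norm_real, Real.norm_eq_abs, Real.norm_eq_abs]

/-- Without stationary points, integrate by parts with `q = G/φ'`. The lower bound on `φ'` and the
bound on `φ''` make `q` and `q'` integrable. -/
theorem exists_norm_integral_Ioi_oscillation_le {φ φ1 φ2 G G1 : ℝ → ℝ} {b δ M : ℝ}
    (hφ : ∀ z, HasDerivAt φ (φ1 z) z) (hφ1 : ∀ z, HasDerivAt φ1 (φ2 z) z) (hφ2 : Continuous φ2)
    (hδ : 0 < δ) (hφδ : ∀ z, b ≤ z → δ ≤ φ1 z) (hφM : ∀ z, b ≤ z → |φ2 z| ≤ M)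
    (hG : ∀ z, HasDerivAt G (G1 z) z) (hG1 : Continuous G1)
    (hGi : IntegrableOn G (Ioi b)) (hG1i : IntegrableOn G1 (Ioi b)) :
    ∃ M, ∀ t : ℝ, 0 < t →
      ‖∫ z in Ioi b, Complex.exp (Complex.I * (t * φ z : ℝ)) * (G z : ℂ)‖ ≤ M / t := by
  have hφc : Continuous φ := continuous_iff_continuousAt.2 fun z => (hφ z).continuousAt
  have hφ1c : Continuous φ1 := continuous_iff_continuousAt.2 fun z => (hφ1 z).continuousAt
  have hGc : Continuous G := continuous_iff_continuousAt.2 fun z => (hG z).continuousAt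
  set q : ℝ → ℝ := fun z => G z / φ1 z with hq
  set q1 : ℝ → ℝ := fun z => G1 z / φ1 z - G z * φ2 z / φ1 z ^ 2 with hq1
  have hpos : ∀ z, b ≤ z → 0 < φ1 z := fun z hz => hδ.trans_le (hφδ z hz)
  have hqd : ∀ z, b ≤ z → HasDerivAt q (q1 z) z := by
    intro z hz
    have := (hpos z hz).ne'
    refine ((hG z).div (hφ1 z) this).congr_deriv ?_
    simp only [hq1]
    field_simp
  have hqi : IntegrableOn q (Ioi b) := by
    refine (hGi.norm.mul_const δ⁻¹).mono' (Measurable.aestronglyMeasurable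
      (hGc.measurable.div hφ1c.measurable)) ((ae_restrict_mem measurableSet_Ioi).mono fun z hz => ?_)
    rw [norm_div, Real.norm_of_nonneg (hpos z (le_of_lt hz)).le, div_eq_mul_inv]
    exact mul_le_mul_of_nonneg_left (inv_anti₀ hδ (hφδ z (le_of_lt hz))) (norm_nonneg _)
  have hq1i : IntegrableOn q1 (Ioi b) := by
    refine ((hG1i.norm.mul_const δ⁻¹).add (hGi.norm.mul_const (M / δ ^ 2))).mono'
      (Measurable.aestronglyMeasurable ((hG1.measurable.div hφ1c.measurable).sub
        ((hGc.measurable.mul hφ2.measurable).div (hφ1c.measurable.pow_const 2))))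
      ((ae_restrict_mem measurableSet_Ioi).mono fun z hz => ?_)
    have hz' : b ≤ z := le_of_lt hz
    refine (norm_sub_le _ _).trans (add_le_add ?_ ?_)
    · rw [norm_div, Real.norm_of_nonneg (hpos z hz').le, div_eq_mul_inv]
      exact mul_le_mul_of_nonneg_left (inv_anti₀ hδ (hφδ z hz')) (norm_nonneg _)
    · rw [norm_div, norm_mul, norm_pow, Real.norm_of_nonneg (hpos z hz').le, mul_div_assoc]
      have := hφδ z hz'
      have := hφM z hz'
      rw [Real.norm_eq_abs (φ2 z)]
      refine mul_le_mul_of_nonneg_left ?_ (norm_nonneg _)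
      gcongr
      exact (abs_nonneg _).trans this
  -- Integrability of both `q` and `q'` removes the boundary term at infinity.
  have hq0 : Tendsto q atTop (𝓝 0) :=
    tendsto_zero_of_hasDerivAt_of_integrableOn_Ioi (fun z hz => hqd z (le_of_lt hz)) hq1i hqi
  have hmul : ∀ (t : ℝ) {f : ℝ → ℝ}, IntegrableOn f (Ioi b) →
      IntegrableOn (fun z => Complex.exp (Complex.I * (t * φ z : ℝ)) * (f z : ℂ)) (Ioi b) := by
    intro t f hf
    refine (hf.ofReal (𝕜 := ℂ)).bdd_mul (c := 1) (Continuous.aestronglyMeasurable (by fun_prop))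
      (Eventually.of_forall fun z => ?_)
    rw [Complex.norm_exp_I_mul_ofReal]
  refine ⟨|q b| + ∫ z in Ioi b, |q1 z|, fun t ht => ?_⟩
  have hd : ∀ z ∈ Ici b, HasDerivAt (fun z => Complex.exp (Complex.I * (t * φ z : ℝ)) * (q z : ℂ))
      (Complex.I * t * (Complex.exp (Complex.I * (t * φ z : ℝ)) * (G z : ℂ)) +
        Complex.exp (Complex.I * (t * φ z : ℝ)) * q1 z) z := by
    intro z hz
    have h1 := hasDerivAt_oscillation t (hφ z) (hqd z hz)
    have h2 : φ1 z * q z = G z := mul_div_cancel₀ _ (hpos z hz).ne'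
    rwa [h2] at h1
  have hlim : Tendsto (fun z => Complex.exp (Complex.I * (t * φ z : ℝ)) * (q z : ℂ)) atTop (𝓝 0) := by
    rw [tendsto_zero_iff_norm_tendsto_zero]
    simpa only [norm_mul, Complex.norm_exp_I_mul_ofReal, one_mul, Complex.norm_real, norm_zero]
      using hq0.norm
  have hftc := integral_Ioi_of_hasDerivAt_of_tendsto' hd
    (((hmul t hGi).const_mul _).add (hmul t hq1i)) hlim
  rw [integral_add ((hmul t hGi).const_mul _) (hmul t hq1i), integral_const_mul] at hftc
  have h1 : ‖∫ z in Ioi b, Complex.exp (Complex.I * (t * φ z : ℝ)) * (q1 z : ℂ)‖ ≤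
      ∫ z in Ioi b, |q1 z| := by
    refine (norm_integral_le_integral_norm _).trans (le_of_eq ?_)
    simp only [norm_mul, Complex.norm_exp_I_mul_ofReal, one_mul, Complex.norm_real,
      Real.norm_eq_abs]
  have h2 := congrArg norm (eq_sub_of_add_eq hftc)
  rw [norm_mul, norm_mul, Complex.norm_I, one_mul, Complex.norm_real, Real.norm_of_nonneg ht.le]
    at h2
  rw [le_div_iff₀ ht, mul_comm, h2]
  refine (norm_sub_le _ _).trans (add_le_add (le_of_eq ?_) h1)
  rw [zero_sub, norm_neg, norm_mul, Complex.norm_exp_I_mul_ofReal, one_mul, Complex.norm_real,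
    Real.norm_eq_abs]

/-- The oscillatory integral with a quadratic phase over an interval around the origin. -/
theorem norm_fresnel_interval_sub_le {t A B : ℝ} (ht : 0 < t) (hA : A < 0) (hB : 0 < B) :
    ‖(∫ u in A..B, Complex.exp (Complex.I * (t * u ^ 2 : ℝ))) -
      Real.sqrt (Real.pi / t) * Complex.exp (Complex.I * (Real.pi / 4 : ℝ))‖ ≤
      (1 / -A + 1 / B) / t := by
  have hc : Continuous fun u : ℝ => Complex.exp (Complex.I * (t * u ^ 2 : ℝ)) := by fun_prop
  have h1 : ∫ u in A..0, Complex.exp (Complex.I * (t * u ^ 2 : ℝ)) =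
      ∫ u in (0 : ℝ)..-A, Complex.exp (Complex.I * (t * u ^ 2 : ℝ)) := by
    have := intervalIntegral.integral_comp_neg (a := A) (b := 0)
      fun u : ℝ => Complex.exp (Complex.I * (t * u ^ 2 : ℝ))
    simpa only [neg_sq, neg_zero] using this
  rw [← intervalIntegral.integral_add_adjacent_intervals (hc.intervalIntegrable A 0)
    (hc.intervalIntegrable 0 B), h1]
  have h2 := norm_fresnel_sub_le ht (neg_pos.2 hA)
  have h3 := norm_fresnel_sub_le ht hB
  have h4 := (norm_add_le _ _).trans (add_le_add h2 h3)
  refine (le_of_eq (congrArg norm ?_)).trans (h4.trans (le_of_eq ?_))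
  · ring
  · have := hA.ne
    field_simp

/-- The stationary phase expansion on an interval around a nondegenerate stationary point of a
convex phase. -/
theorem exists_norm_stationaryPhase_sub_le {φ φ1 φ2 G : ℝ → ℝ} {a h b : ℝ}
    (hφ : ∀ z, HasDerivAt φ (φ1 z) z) (hφ1 : ∀ z, HasDerivAt φ1 (φ2 z) z) (hφ2 : ContDiff ℝ 3 φ2)
    (hpos : ∀ z, 0 < φ2 z) (hh : φ1 h = 0) (hah : a < h) (hhb : h < b) (hG : ContDiff ℝ 2 G) :
    ∃ M, ∀ t : ℝ, 0 < t →
      ‖(∫ z in a..b, Complex.exp (Complex.I * (t * φ z : ℝ)) * (G z : ℂ)) -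
        (G h * Real.sqrt (2 * Real.pi / φ2 h) : ℝ) * Complex.exp (Complex.I * (Real.pi / 4 : ℝ)) *
          (Complex.exp (Complex.I * (t * φ h : ℝ)) / (Real.sqrt t : ℂ))‖ ≤ M / t := by
  have hφc : Continuous φ := continuous_iff_continuousAt.2 fun z => (hφ z).continuousAt
  have hφ1c : Continuous φ1 := continuous_iff_continuousAt.2 fun z => (hφ1 z).continuousAt
  have hφ2c : Continuous φ2 := hφ2.continuous
  -- `φ' = (z - h) R` and `φ = φ(h) + (z - h)² K`; convexity makes `R` and `K` positive everywhere.
  set R : ℝ → ℝ := fun z => ∫ θ in (0 : ℝ)..1, 1 * φ2 (h + θ * (z - h)) with hR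
  set K : ℝ → ℝ := fun z => ∫ θ in (0 : ℝ)..1, (1 - θ) * φ2 (h + θ * (z - h)) with hK
  have hRs : ContDiff ℝ 3 R := contDiff_intervalIntegral_weight (n := 3) hφ2 contDiff_const h
  have hKs : ContDiff ℝ 3 K := contDiff_intervalIntegral_weight (n := 3) hφ2 (by fun_prop) h
  have hRpos : ∀ z, 0 < R z := fun z => by
    refine intervalIntegral.intervalIntegral_pos_of_pos
      (Continuous.intervalIntegrable (by fun_prop) _ _) (fun θ => ?_) one_pos
    rw [one_mul]; exact hpos _
  have hKpos : ∀ z, 0 < K z := fun z => by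
    refine intervalIntegral.intervalIntegral_pos_of_pos_on
      (Continuous.intervalIntegrable (by fun_prop) _ _) (fun θ hθ => ?_) one_pos
    exact mul_pos (sub_pos.2 hθ.2) (hpos _)
  have hKh : K h = φ2 h / 2 := by
    simp only [hK, sub_self, mul_zero, add_zero]
    rw [intervalIntegral.integral_mul_const, intervalIntegral.integral_sub (by simp) (by simp)]
    norm_num
    ring
  have hφ1R : ∀ z, φ1 z = (z - h) * R z := fun z => by
    simpa [hh, hR] using eq_add_mul_intervalIntegral_deriv hφ1 hφ2c h z
  have hφK : ∀ z, φ z = φ h + (z - h) ^ 2 * K z := fun z => by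
    simpa [hh, hK] using eq_taylor_two hφ hφ1 hφ2c h z
  -- The Morse coordinate, with `φ = φ(h) + S²`. Its inverse is never needed: the substitution is
  -- applied only to integrands carrying the factor `S'`.
  set S : ℝ → ℝ := fun z => (z - h) * Real.sqrt (K z) with hS
  have hSs : ContDiff ℝ 3 S :=
    (contDiff_id.sub contDiff_const).mul (hKs.sqrt fun z => (hKpos z).ne')
  have hSd : ∀ z, HasDerivAt S (deriv S z) z := fun z =>
    (hSs.differentiable (by norm_num) z).hasDerivAt
  have hS1 : ContDiff ℝ 2 (deriv S) := by
    have : ContDiff ℝ (2 + 1) S := hSs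
    exact (contDiff_succ_iff_deriv.1 this).2.2
  have hS1h : deriv S h = Real.sqrt (K h) := by
    have hsq : HasDerivAt (fun z => Real.sqrt (K z)) (deriv (fun z => Real.sqrt (K z)) h) h :=
      ((hKs.sqrt fun z => (hKpos z).ne').differentiable (by norm_num) h).hasDerivAt
    have hd : HasDerivAt S _ h := ((hasDerivAt_id h).sub_const h).mul hsq
    simpa using hd.deriv
  have hSsq : ∀ z, φ z = φ h + S z ^ 2 := fun z => by
    rw [hφK z, hS, mul_pow, Real.sq_sqrt (hKpos z).le]
  have hKh0 : 0 < Real.sqrt (K h) := Real.sqrt_pos.2 (hKpos h)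
  -- Chosen so that `N = G - α S'` vanishes at `h`, where `S' = √K`.
  set α : ℝ := G h / Real.sqrt (K h) with hα
  set N : ℝ → ℝ := fun z => G z - α * deriv S z with hN
  have hNs : ContDiff ℝ 2 N := hG.sub (contDiff_const.mul hS1)
  have hNd : ∀ z, HasDerivAt N (deriv N z) z := fun z =>
    (hNs.differentiable (by norm_num) z).hasDerivAt
  have hN1 : ContDiff ℝ 1 (deriv N) := by
    have : ContDiff ℝ (1 + 1) N := hNs
    exact (contDiff_succ_iff_deriv.1 this).2.2
  have hNh : N h = 0 := by
    simp only [hN, hS1h, hα]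
    field_simp
    ring
  set P : ℝ → ℝ := fun z => ∫ θ in (0 : ℝ)..1, 1 * deriv N (h + θ * (z - h)) with hP
  have hPs : ContDiff ℝ 1 P := contDiff_intervalIntegral_weight (n := 1) hN1 contDiff_const h
  have hNP : ∀ z, N z = (z - h) * P z := fun z => by
    simpa [hNh, hP] using eq_add_mul_intervalIntegral_deriv hNd hN1.continuous h z
  -- The zeros of `N` and `φ'` at `h` cancel, so `N = φ' q`. One derivative is lost in passing from
  -- `N` to `P`; this is why `S` is taken C³ and `G` C².
  set q : ℝ → ℝ := fun z => P z / R z with hq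
  have hqs : ContDiff ℝ 1 q := hPs.div (hRs.of_le (by norm_num)) fun z => (hRpos z).ne'
  have hNq : ∀ z, φ1 z * q z = N z := fun z => by
    rw [hφ1R, hNP, hq]
    have := (hRpos z).ne'
    field_simp
  obtain ⟨M, hM⟩ := exists_norm_intervalIntegral_oscillation_le hφ hφ1c hqs a b
  have hSa : S a < 0 := mul_neg_of_neg_of_pos (sub_neg.2 hah) (Real.sqrt_pos.2 (hKpos a))
  have hSb : 0 < S b := mul_pos (sub_pos.2 hhb) (Real.sqrt_pos.2 (hKpos b))
  refine ⟨M + |α| * (1 / -S a + 1 / S b), fun t ht => ?_⟩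
  have hGsplit : ∀ z, Complex.exp (Complex.I * (t * φ z : ℝ)) * (G z : ℂ) =
      Complex.exp (Complex.I * (t * φ z : ℝ)) * (φ1 z * q z : ℝ) +
        α * Complex.exp (Complex.I * (t * φ h : ℝ)) *
          (((deriv S z : ℝ) : ℂ) * Complex.exp (Complex.I * (t * S z ^ 2 : ℝ))) := fun z => by
    rw [hNq z]
    have h1 : Complex.exp (Complex.I * (t * φ z : ℝ)) = Complex.exp (Complex.I * (t * φ h : ℝ)) *
        Complex.exp (Complex.I * (t * S z ^ 2 : ℝ)) := by
      rw [← Complex.exp_add, hSsq z]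
      push_cast
      ring_nf
    rw [h1]
    simp only [hN]
    push_cast
    ring
  have hsub : ∫ z in a..b, ((deriv S z : ℝ) : ℂ) * Complex.exp (Complex.I * (t * S z ^ 2 : ℝ)) =
      ∫ u in S a..S b, Complex.exp (Complex.I * (t * u ^ 2 : ℝ)) := by
    have := intervalIntegral.integral_deriv_smul_comp (a := a) (b := b) (f := S) (f' := deriv S)
      (g := fun u : ℝ => Complex.exp (Complex.I * (t * u ^ 2 : ℝ)))
      (fun z _ => hSd z) hS1.continuous.continuousOn (by fun_prop)
    simpa only [Function.comp, Complex.real_smul] using this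
  have hSc := hSs.continuous
  have hS1c := hS1.continuous
  have hqc := hqs.continuous
  have hint : ∫ z in a..b, Complex.exp (Complex.I * (t * φ z : ℝ)) * (G z : ℂ) =
      (∫ z in a..b, Complex.exp (Complex.I * (t * φ z : ℝ)) * (φ1 z * q z : ℝ)) +
        α * Complex.exp (Complex.I * (t * φ h : ℝ)) *
          ∫ u in S a..S b, Complex.exp (Complex.I * (t * u ^ 2 : ℝ)) := by
    simp_rw [hGsplit]
    rw [intervalIntegral.integral_add (Continuous.intervalIntegrable (by fun_prop) _ _)
      (Continuous.intervalIntegrable (by fun_prop) _ _), intervalIntegral.integral_const_mul, hsub]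
  -- As `K h = φ2 h / 2`, the coefficient equals `α √π`; writing `√π = √(π/t) √t` matches the
  -- Fresnel integral.
  have hcoef : ((G h * Real.sqrt (2 * Real.pi / φ2 h) : ℝ) : ℂ) =
      (α * (Real.sqrt (Real.pi / t) * Real.sqrt t) : ℝ) := by
    congr 1
    rw [← Real.sqrt_mul (by positivity), div_mul_cancel₀ _ ht.ne', hα, div_mul_eq_mul_div,
      mul_div_assoc (G h) (Real.sqrt Real.pi), ← Real.sqrt_div Real.pi_pos.le, hKh]
    congr 2
    have := (hpos h).ne'
    field_simp
  have hst : (Real.sqrt t : ℂ) ≠ 0 := by exact_mod_cast (Real.sqrt_pos.2 ht).ne'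
  have hfinal : ((∫ z in a..b, Complex.exp (Complex.I * (t * φ z : ℝ)) * (G z : ℂ)) -
        (G h * Real.sqrt (2 * Real.pi / φ2 h) : ℝ) * Complex.exp (Complex.I * (Real.pi / 4 : ℝ)) *
          (Complex.exp (Complex.I * (t * φ h : ℝ)) / (Real.sqrt t : ℂ))) =
      (∫ z in a..b, Complex.exp (Complex.I * (t * φ z : ℝ)) * (φ1 z * q z : ℝ)) +
        α * Complex.exp (Complex.I * (t * φ h : ℝ)) *
          ((∫ u in S a..S b, Complex.exp (Complex.I * (t * u ^ 2 : ℝ))) -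
            Real.sqrt (Real.pi / t) * Complex.exp (Complex.I * (Real.pi / 4 : ℝ))) := by
    rw [hint, hcoef, Complex.ofReal_mul α, Complex.ofReal_mul (Real.sqrt (Real.pi / t))]
    field_simp
    ring
  rw [hfinal, add_div]
  refine (norm_add_le _ _).trans (add_le_add (hM t ht) ?_)
  rw [norm_mul, norm_mul, Complex.norm_exp_I_mul_ofReal, mul_one, Complex.norm_real,
    Real.norm_eq_abs, mul_div_assoc]
  exact mul_le_mul_of_nonneg_left (norm_fresnel_interval_sub_le ht hSa hSb) (abs_nonneg _)

/-! ## Convolution on the half line -/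

theorem hasDerivAt_intervalIntegral_of_continuous {E : Type*} [NormedAddCommGroup E]
    [NormedSpace ℝ E] {f f1 : ℝ → ℝ → E} (a b : ℝ)
    (hf : ContDiff ℝ 1 (Function.uncurry f)) (hf1 : ∀ x θ, HasDerivAt (fun x => f x θ) (f1 x θ) x)
    (x : ℝ) :
    HasDerivAt (fun x => ∫ θ in a..b, f x θ) (∫ θ in a..b, f1 x θ) x := by
  have h := hasDerivAt_intervalIntegral_of_contDiff a b hf x
  have h1 : ∀ θ, fderiv ℝ (Function.uncurry f) (x, θ) (1, 0) = f1 x θ := fun θ => by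
    have h2 := (hf.differentiable one_ne_zero (x, θ)).hasFDerivAt
    have h3 : HasDerivAt (fun y => (y, θ)) ((1 : ℝ), (0 : ℝ)) x :=
      (hasDerivAt_id x).prodMk (hasDerivAt_const x θ)
    have h4 := h2.comp_hasDerivAt x h3
    exact h4.unique (hf1 x θ)
  simpa only [h1] using h

/-- The convolution of two functions on the half line. -/
noncomputable def halfLineConv (f F : ℝ → ℝ) (z : ℝ) : ℝ := ∫ y in (0 : ℝ)..z, f y * F (z - y)

/-- Rescaling fixes the endpoints, so that smoothness in `z` follows from the lemmas on parametric
integrals. -/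
theorem halfLineConv_eq_mul (f F : ℝ → ℝ) :
    halfLineConv f F = fun z => z * ∫ θ in (0 : ℝ)..1, f (z * θ) * F (z - z * θ) := by
  ext z
  have := intervalIntegral.mul_integral_comp_mul_left (a := 0) (b := 1) (c := z)
    (f := fun y => f y * F (z - y))
  rw [this, mul_zero, mul_one, halfLineConv]

theorem halfLineConv_comm (f F : ℝ → ℝ) : halfLineConv f F = halfLineConv F f := by
  ext z
  have := intervalIntegral.integral_comp_sub_left (a := 0) (b := z) (fun y => f y * F (z - y)) z
  rw [sub_zero, sub_self] at this
  rw [halfLineConv, ← this, halfLineConv]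
  simp [mul_comm]

theorem ContDiff.halfLineConv {f F : ℝ → ℝ} {n : ℕ} (hf : ContDiff ℝ n f) (hF : ContDiff ℝ n F) :
    ContDiff ℝ n (halfLineConv f F) := by
  rw [halfLineConv_eq_mul]
  exact contDiff_id.mul (contDiff_intervalIntegral 0 1 n
    (f := fun z θ => f (z * θ) * F (z - z * θ))
    ((hf.comp (by fun_prop)).mul (hF.comp (by fun_prop))))

theorem hasDerivAt_halfLineConv {f F : ℝ → ℝ} (hf : ContDiff ℝ 1 f) (hF : ContDiff ℝ 1 F) (z : ℝ) :
    HasDerivAt (halfLineConv f F) (f z * F 0 + halfLineConv f (deriv F) z) z := by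
  have hf1 : Continuous (deriv f) := hf.continuous_deriv le_rfl
  have hF1 : Continuous (deriv F) := hF.continuous_deriv le_rfl
  have hfc := hf.continuous
  have hFc := hF.continuous
  have hfd : ∀ x, HasDerivAt f (deriv f x) x := fun x =>
    (hf.differentiable one_ne_zero x).hasDerivAt
  have hFd : ∀ x, HasDerivAt F (deriv F x) x := fun x =>
    (hF.differentiable one_ne_zero x).hasDerivAt
  have h1 := hasDerivAt_intervalIntegral_of_continuous
    (f := fun z θ => f (z * θ) * F (z - z * θ))
    (f1 := fun z θ => (θ * deriv f (z * θ)) * F (z - z * θ) +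
      f (z * θ) * ((1 - θ) * deriv F (z - z * θ))) 0 1
    ((hf.comp (by fun_prop)).mul (hF.comp (by fun_prop))) (fun x θ => by
      have ha : HasDerivAt (fun x => x * θ) θ x := by simpa using (hasDerivAt_id x).mul_const θ
      have hb : HasDerivAt (fun x => x - x * θ) (1 - θ) x := (hasDerivAt_id x).sub ha
      refine (((hfd _).comp x ha).mul ((hFd _).comp x hb)).congr_deriv ?_
      simp only [Function.comp]
      ring) z
  -- Integrating this total derivative yields `f(z) F(0)` and trades the terms with `f'` for terms
  -- with `F'`.
  have h2 : ∀ θ ∈ uIcc (0 : ℝ) 1, HasDerivAt (fun θ => θ * (f (z * θ) * F (z - z * θ)))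
      (f (z * θ) * F (z - z * θ) + z * (θ * deriv f (z * θ) * F (z - z * θ) -
        θ * (f (z * θ) * deriv F (z - z * θ)))) θ := fun θ _ => by
    have ha : HasDerivAt (fun θ => z * θ) z θ := by simpa using (hasDerivAt_id θ).const_mul z
    have hb : HasDerivAt (fun θ => z - z * θ) (-z) θ := by simpa using ha.const_sub z
    refine ((hasDerivAt_id θ).mul (((hfd _).comp θ ha).mul ((hFd _).comp θ hb))).congr_deriv ?_
    simp only [Function.comp, id, Pi.mul_apply]
    ring
  have h3 := intervalIntegral.integral_eq_sub_of_hasDerivAt h2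
    (Continuous.intervalIntegrable (by fun_prop) _ _)
  rw [halfLineConv_eq_mul f F, halfLineConv_eq_mul f (deriv F)]
  refine ((hasDerivAt_id z).mul h1).congr_deriv ?_
  simp only [id, one_mul, mul_one, sub_self, zero_mul, sub_zero] at h3 ⊢
  rw [← h3, ← intervalIntegral.integral_const_mul, ← intervalIntegral.integral_const_mul,
    ← intervalIntegral.integral_add (Continuous.intervalIntegrable (by fun_prop) _ _)
      (Continuous.intervalIntegrable (by fun_prop) _ _),
    ← intervalIntegral.integral_add (Continuous.intervalIntegrable (by fun_prop) _ _)
      (Continuous.intervalIntegrable (by fun_prop) _ _)]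
  congr 1
  ext θ
  ring

theorem integrableOn_halfLineConv {f F : ℝ → ℝ} (hf : IntegrableOn f (Ioi 0))
    (hF : IntegrableOn F (Ioi 0)) : IntegrableOn (halfLineConv f F) (Ioi 0) := by
  have h := integrable_posConvolution hf hF (ContinuousLinearMap.mul ℝ ℝ)
  rw [posConvolution, integrable_indicator_iff measurableSet_Ioi] at h
  exact h

/-- Twice continuously differentiable functions that are integrable on the half line together with
their first derivative. -/
structure SmoothDensity (f : ℝ → ℝ) : Prop where
  contDiff : ContDiff ℝ 2 f
  integrableOn : IntegrableOn f (Ioi 0)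
  integrableOn_deriv : IntegrableOn (deriv f) (Ioi 0)

theorem SmoothDensity.halfLineConv {f F : ℝ → ℝ} (hf : SmoothDensity f) (hF : SmoothDensity F) :
    SmoothDensity (halfLineConv f F) where
  contDiff := ContDiff.halfLineConv (n := 2) hf.contDiff hF.contDiff
  integrableOn := integrableOn_halfLineConv hf.integrableOn hF.integrableOn
  integrableOn_deriv := by
    rw [funext fun z => (hasDerivAt_halfLineConv (hf.contDiff.of_le one_le_two)
      (hF.contDiff.of_le one_le_two) z).deriv]
    exact (hf.integrableOn.mul_const _).add
      (integrableOn_halfLineConv hf.integrableOn hF.integrableOn_deriv)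

/-- The convolution of `m + 1` copies of a function on the half line. -/
noncomputable def iteratedConv (g : ℝ → ℝ) : ℕ → ℝ → ℝ
  | 0 => g
  | m + 1 => halfLineConv g (iteratedConv g m)

theorem SmoothDensity.iteratedConv {g : ℝ → ℝ} (hg : SmoothDensity g) (m : ℕ) :
    SmoothDensity (iteratedConv g m) := by
  induction m with
  | zero => exact hg
  | succ m ih => exact hg.halfLineConv ih

/-- Fubini and the substitution `z = x + y`, after extending `f` and `F` by zero to the line;
boundedness of `Φ` gives joint integrability. -/
theorem integral_add_smul_smul_eq_halfLineConv {E : Type*} [NormedAddCommGroup E]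
    [NormedSpace ℝ E] [CompleteSpace E] {f F : ℝ → ℝ} (hf : IntegrableOn f (Ioi 0)) (hF : IntegrableOn F (Ioi 0))
    {Φ : ℝ → E} (hΦ : StronglyMeasurable Φ) {M : ℝ} (hM : ∀ z, ‖Φ z‖ ≤ M) :
    ∫ x in Ioi 0, f x • ∫ y in Ioi 0, F y • Φ (x + y) =
      ∫ z in Ioi 0, halfLineConv f F z • Φ z := by
  set u : ℝ → ℝ := (Ioi 0).indicator f with hu
  set v : ℝ → ℝ := (Ioi 0).indicator F with hv
  have hui : Integrable u := (integrable_indicator_iff measurableSet_Ioi).2 hf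
  have hvi : Integrable v := (integrable_indicator_iff measurableSet_Ioi).2 hF
  have hint : Integrable (Function.uncurry fun z x => (u x * v (z - x)) • Φ z)
      (volume.prod volume) := by
    have h1 := hui.convolution_integrand (ContinuousLinearMap.mul ℝ ℝ) hvi
    exact h1.smul_bdd M (hΦ.comp_measurable measurable_fst).aestronglyMeasurable
      (Eventually.of_forall fun p => hM p.1)
  have hswap := integral_integral_swap hint
  have hl : ∀ z, ∫ x, (u x * v (z - x)) • Φ z = (Ioi 0).indicator (halfLineConv f F) z • Φ z := by
    intro z
    rw [integral_smul_const]
    congr 1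
    by_cases hz : 0 < z
    · rw [indicator_of_mem (mem_Ioi.2 hz), halfLineConv, intervalIntegral.integral_of_le hz.le,
        integral_Ioc_eq_integral_Ioo, ← integral_indicator measurableSet_Ioo]
      congr 1
      ext x
      by_cases hx : 0 < x <;> by_cases hxz : x < z <;>
        simp [hu, hv, indicator, hx, hxz]
    · rw [indicator_of_notMem (notMem_Ioi.2 (not_lt.1 hz))]
      refine integral_eq_zero_of_ae (Eventually.of_forall fun x => ?_)
      by_cases hx : 0 < x
      · have : ¬ x < z := by linarith [not_lt.1 hz]
        simp [hv, this]
      · simp [hu, hx]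
  have hr : ∀ x, ∫ z, (u x * v (z - x)) • Φ z = u x • ∫ y in Ioi 0, F y • Φ (x + y) := by
    intro x
    rw [← integral_add_left_eq_self (fun z => (u x * v (z - x)) • Φ z) x,
      ← integral_indicator measurableSet_Ioi, ← integral_smul]
    congr 1
    ext y
    by_cases hy : 0 < y <;> simp [hv, indicator, hy, mul_smul]
  simp_rw [hl, hr] at hswap
  rw [← integral_indicator measurableSet_Ioi, ← integral_indicator measurableSet_Ioi]
  simp_rw [indicator_smul_left (Ioi (0 : ℝ))]
  exact hswap.symm

open EinsteinRosen in
/-- The distribution of `w₁ + ⋯ + w_{m+1}` under the product density `∏ g(wⱼ)`. -/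
theorem integral_prod_smul_sum_eq {E : Type*} [NormedAddCommGroup E]
    [NormedSpace ℝ E] [CompleteSpace E] {g : ℝ → ℝ} (hg : IntegrableOn g (Ioi 0)) (m : ℕ)
    {Φ : ℝ → E} (hΦ : StronglyMeasurable Φ) {M : ℝ} (hM : ∀ z, ‖Φ z‖ ≤ M) :
    IntegrableOn (iteratedConv g m) (Ioi 0) ∧
    ∫ w, (∏ j, g (w j)) • Φ (∑ j, w j) ∂modeMeasure (m + 1) =
      ∫ z in Ioi 0, iteratedConv g m z • Φ z := by
  induction m generalizing Φ with
  | zero =>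
    refine ⟨hg, ?_⟩
    rw [← (measurePreserving_funUnique halfLine (Fin 1)).integral_comp']
    have h1 : ∀ w : Fin (0 + 1) → ℝ, (∏ j, g (w j)) • Φ (∑ j, w j) = g (w 0) • Φ (w 0) :=
      fun w => by simp
    simp_rw [h1]
    congr!
  | succ m ih =>
    have hmi := (ih hΦ hM).1
    refine ⟨integrableOn_halfLineConv hg hmi, ?_⟩
    have hmp := measurePreserving_piFinSuccAbove (fun _ : Fin (m + 2) => halfLine) 0
    have h1 : ∫ w, (∏ j, g (w j)) • Φ (∑ j, w j) ∂modeMeasure (m + 1 + 1) =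
        ∫ p : ℝ × (Fin (m + 1) → ℝ), (g p.1 * ∏ j, g (p.2 j)) • Φ (p.1 + ∑ j, p.2 j)
          ∂(halfLine.prod (modeMeasure (m + 1))) := by
      rw [← hmp.integral_comp']
      congr 1
      ext w
      simp [Fin.prod_univ_succ, Fin.sum_univ_succ, Fin.tail]
    have hprod : Integrable (fun w : Fin (m + 1) → ℝ => ∏ j, g (w j)) (modeMeasure (m + 1)) :=
      Integrable.fintype_prod (f := fun _ => g) (μ := fun _ => halfLine) fun _ => hg
    have hint : Integrable (fun p : ℝ × (Fin (m + 1) → ℝ) =>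
        (g p.1 * ∏ j, g (p.2 j)) • Φ (p.1 + ∑ j, p.2 j)) (halfLine.prod (modeMeasure (m + 1))) :=
      (Integrable.mul_prod (μ := halfLine) hg hprod).smul_bdd M
        (hΦ.comp_measurable (by fun_prop)).aestronglyMeasurable (Eventually.of_forall fun p => hM _)
    rw [h1, integral_prod _ hint]
    simp_rw [mul_smul, integral_smul]
    -- The induction hypothesis is used for the translates `Φ(x + ·)`, hence the generalisation over
    -- `Φ`.
    have h2 : ∀ x, ∫ w, (∏ j, g (w j)) • Φ (x + ∑ j, w j) ∂modeMeasure (m + 1) =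
        ∫ z in Ioi 0, iteratedConv g m z • Φ (x + z) := fun x =>
      (ih (Φ := fun z => Φ (x + z)) (hΦ.comp_measurable (by fun_prop)) fun z => hM _).2
    simp_rw [h2]
    exact integral_add_smul_smul_eq_halfLineConv hg hmi hΦ hM

/-! ## Extension of functions from the half line -/

/-- Extend the derivative by induction and integrate it from `0`; a continuous function is extended
by its value at `0`. -/
theorem exists_contDiff_eqOn_Ici {E : Type*} [NormedAddCommGroup E] [NormedSpace ℝ E]
    [CompleteSpace E] (n : ℕ) {f : ℝ → E} (hf : ContDiffOn ℝ n f (Ici 0)) :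
    ∃ F : ℝ → E, ContDiff ℝ n F ∧ EqOn F f (Ici 0) := by
  induction n generalizing f with
  | zero =>
    refine ⟨fun x => f (max x 0), ?_, fun x hx => by simp [max_eq_left (mem_Ici.1 hx)]⟩
    rw [Nat.cast_zero, contDiff_zero]
    exact hf.continuousOn.comp_continuous (by fun_prop) fun x => mem_Ici.2 (le_max_right _ _)
  | succ n ih =>
    have hf' : ContDiffOn ℝ n (derivWithin f (Ici 0)) (Ici 0) :=
      hf.derivWithin (uniqueDiffOn_Ici 0) (by norm_cast)
    obtain ⟨F1, hF1, hF1f⟩ := ih hf'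
    have hd : ∀ x, HasDerivAt (fun x => f 0 + ∫ y in (0 : ℝ)..x, F1 y) (F1 x) x := fun x =>
      (hF1.continuous.integral_hasStrictDerivAt 0 x).hasDerivAt.const_add _
    refine ⟨fun x => f 0 + ∫ y in (0 : ℝ)..x, F1 y, ?_, ?_⟩
    · push_cast
      rw [contDiff_succ_iff_deriv]
      refine ⟨fun x => (hd x).differentiableAt, by simp, ?_⟩
      rwa [funext fun x => (hd x).deriv]
    · intro x hx
      have := intervalIntegral.integral_eq_sub_of_hasDerivAt_of_le (mem_Ici.1 hx)
        (hf.continuousOn.mono Icc_subset_Ici_self) (f' := F1) (fun y hy => by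
          have h1 : DifferentiableWithinAt ℝ f (Ici 0) y :=
            (hf y hy.1.le).differentiableWithinAt (by norm_cast)
          have h2 := h1.hasDerivWithinAt
          rw [← hF1f (mem_Ici.2 hy.1.le)] at h2
          exact h2.hasDerivAt (Ici_mem_nhds hy.1)) (hF1.continuous.intervalIntegrable _ _)
      simp [this]

namespace EinsteinRosen

/-! ## The energy density -/

/-- Partial sums of nonnegative numbers increase, so the last constraint implies the others. At
least one variable is needed: with none, the left side carries no condition on `z`. -/
theorem setOf_partial_sums_eq (m : ℕ) (z : ℝ) :
    {w : Fin (m + 1) → ℝ | ∀ k, 0 ≤ w k ∧ w k < z - ∑ j ∈ Finset.Iio k, w j} =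
      Ici 0 ∩ {w | ∑ j, w j < z} := by
  have hsplit : ∀ (w : Fin (m + 1) → ℝ) k,
      w k + ∑ j ∈ Finset.Iio k, w j = ∑ j ∈ Finset.Iic k, w j := fun w k => by
    rw [← Finset.Iio_insert k, Finset.sum_insert (by simp)]
  ext w
  simp only [mem_ofPred_eq, mem_inter_iff, mem_Ici, Pi.le_def, Pi.zero_apply, lt_sub_iff_add_lt,
    hsplit, forall_and]
  refine and_congr_right fun h0 => ⟨fun h => ?_, fun h k => lt_of_le_of_lt ?_ h⟩
  · have hu : Finset.Iic (Fin.last m) = Finset.univ := by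
      ext k
      simp [Fin.le_last]
    rw [← hu]
    exact h (Fin.last m)
  · exact Finset.sum_le_sum_of_subset_of_nonneg (Finset.subset_univ _) fun j _ _ => h0 j

theorem modeMeasure_eq_restrict (n : ℕ) :
    modeMeasure n = volume.restrict (univ.pi fun _ : Fin n => Ioi (0 : ℝ)) := by
  rw [volume_pi, Measure.restrict_pi_pi]

theorem energyDensity_succ {c : ℝ → ℂ} {g : ℝ → ℝ} (hg : Continuous g)
    (hgi : IntegrableOn g (Ioi 0)) (hcg : ∀ x, 0 ≤ x → ‖c x‖ ^ 2 = g x) (m : ℕ) {z : ℝ}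
    (hz : 0 ≤ z) : energyDensity c (m + 1) z = iteratedConv g m z := by
  cases m with
  | zero =>
    have hv : (volume : Measure (Fin (0 + 1 - 1) → ℝ)) = Measure.dirac 0 :=
      Measure.volume_pi_eq_dirac (ι := Fin 0) 0
    have hu : {w : Fin (0 + 1 - 1) → ℝ | ∀ k, 0 ≤ w k ∧ w k < z - ∑ j ∈ Finset.Iio k, w j} = univ :=
      eq_univ_of_forall fun w k => k.elim0
    rw [energyDensity, hu, hv]
    simp [iteratedConv, hcg z hz]
  | succ m =>
    obtain ⟨M, hM⟩ := (isCompact_Icc (a := (0 : ℝ)) (b := z)).exists_bound_of_continuousOn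
      hg.continuousOn
    -- This test function absorbs the factor `|c(z - ∑ wⱼ)|²` and the constraint `∑ wⱼ < z`; the
    -- cutoff also makes it bounded.
    set Φ : ℝ → ℝ := (Ioo 0 z).indicator fun y => g (z - y) with hΦ
    have hΦm : StronglyMeasurable Φ :=
      (Continuous.stronglyMeasurable (by fun_prop)).indicator measurableSet_Ioo
    have hΦM : ∀ y, ‖Φ y‖ ≤ max M 0 := fun y => by
      by_cases hy : y ∈ Ioo 0 z
      · rw [hΦ, indicator_of_mem hy]
        exact (hM _ ⟨by linarith [hy.2], by linarith [hy.1]⟩).trans (le_max_left _ _)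
      · rw [hΦ, indicator_of_notMem hy, norm_zero]
        exact le_max_right _ _
    have hsum := (integral_prod_smul_sum_eq hgi m hΦm hΦM).2
    have hpos : ∀ w ∈ univ.pi fun _ : Fin (m + 1) => Ioi (0 : ℝ), 0 < ∑ j, w j := fun w hw =>
      Finset.sum_pos (fun j _ => hw j (mem_univ j)) Finset.univ_nonempty
    have hT : MeasurableSet {w : Fin (m + 1) → ℝ | ∑ j, w j < z} :=
      measurableSet_lt (by fun_prop) measurable_const
    have hP : MeasurableSet (univ.pi fun _ : Fin (m + 1) => Ioi (0 : ℝ)) :=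
      MeasurableSet.univ_pi fun _ => measurableSet_Ioi
    have hae : (Ici 0 ∩ {w : Fin (m + 1) → ℝ | ∑ j, w j < z} : Set (Fin (m + 1) → ℝ)) =ᵐ[volume]
        ((univ.pi fun _ : Fin (m + 1) => Ioi (0 : ℝ)) ∩ {w | ∑ j, w j < z} :
          Set (Fin (m + 1) → ℝ)) :=
      (Measure.univ_pi_Ioi_ae_eq_Ici (μ := fun _ : Fin (m + 1) => (volume : Measure ℝ))
        (f := 0)).symm.inter (ae_eq_refl _)
    have h1 : energyDensity c (m + 1 + 1) z =
        ∫ w, (∏ j, g (w j)) • Φ (∑ j, w j) ∂modeMeasure (m + 1) := by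
      rw [modeMeasure_eq_restrict, energyDensity]
      change ∫ w in {w : Fin (m + 1) → ℝ | ∀ k, 0 ≤ w k ∧ w k < z - ∑ j ∈ Finset.Iio k, w j},
        ‖c (z - ∑ j, w j)‖ ^ 2 * ∏ k, ‖c (w k)‖ ^ 2 = _
      rw [setOf_partial_sums_eq, setIntegral_congr_set hae, ← setIntegral_indicator hT]
      refine setIntegral_congr_fun hP fun w hw => ?_
      have hw0 : ∀ j, 0 < w j := fun j => hw j (mem_univ j)
      by_cases hwz : ∑ j, w j < z
      · have hmem : ∑ j, w j ∈ Ioo 0 z := ⟨hpos w hw, hwz⟩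
        simp only [hΦ]
        rw [indicator_of_mem (show w ∈ {w : Fin (m + 1) → ℝ | ∑ j, w j < z} from hwz), indicator_of_mem hmem,
          hcg _ (sub_nonneg.2 hwz.le), smul_eq_mul, mul_comm]
        congr 1
        exact Finset.prod_congr rfl fun k _ => hcg _ (hw0 k).le
      · have hmem : ∑ j, w j ∉ Ioo 0 z := fun h => hwz h.2
        simp only [hΦ]
        rw [indicator_of_notMem (by simpa using hwz), indicator_of_notMem hmem, smul_zero]
    rw [h1, hsum]
    change _ = halfLineConv g (iteratedConv g m) z
    have hI : Ioo 0 z = Ioi 0 ∩ Ioo 0 z := (inter_eq_right.2 Ioo_subset_Ioi_self).symm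
    rw [halfLineConv_comm, halfLineConv, intervalIntegral.integral_of_le hz,
      integral_Ioc_eq_integral_Ioo, hI, ← setIntegral_indicator measurableSet_Ioo]
    refine setIntegral_congr_fun measurableSet_Ioi fun y _ => ?_
    by_cases hy : y ∈ Ioo 0 z <;> simp [hΦ, hy]

/-- The derivative `2 Re⟨F, F'⟩` is dominated by `|F|² + |F'|²`. -/
theorem smoothDensity_norm_sq {c F : ℝ → ℂ} (hc : RegularModes c) (hF : ContDiff ℝ 2 F)
    (hFc : EqOn F c (Ici 0)) : SmoothDensity fun x => ‖F x‖ ^ 2 := by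
  have hF1 : Continuous (deriv F) := hF.continuous_deriv one_le_two
  have hd : ∀ x, HasDerivAt (fun x => ‖F x‖ ^ 2) (2 * inner ℝ (F x) (deriv F x)) x := fun x =>
    (hF.differentiable two_ne_zero x).hasDerivAt.norm_sq
  have h0 : IntegrableOn (fun x => ‖F x‖ ^ 2) (Ioi 0) := by
    have h1 := hc.memLp 0 zero_le_two
    rw [iteratedDerivWithin_zero] at h1
    have h2 : MemLp F 2 halfLine := (memLp_congr_ae ((ae_restrict_mem measurableSet_Ioi).mono
      fun x hx => hFc (mem_Ici.2 (le_of_lt hx)))).2 h1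
    exact (memLp_two_iff_integrable_sq_norm h2.1).1 h2
  have h1 : IntegrableOn (fun x => ‖deriv F x‖ ^ 2) (Ioi 0) := by
    have h1 := hc.memLp 1 one_le_two
    rw [iteratedDerivWithin_one] at h1
    have h2 : MemLp (deriv F) 2 halfLine := by
      refine (memLp_congr_ae ((ae_restrict_mem measurableSet_Ioi).mono fun x hx => ?_)).2 h1
      have hn : Ici (0 : ℝ) ∈ 𝓝 x := Ici_mem_nhds hx
      rw [derivWithin_of_mem_nhds hn]
      exact (eventuallyEq_of_mem hn hFc).deriv_eq
    exact (memLp_two_iff_integrable_sq_norm h2.1).1 h2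
  refine ⟨hF.norm_sq ℝ, h0, ?_⟩
  rw [funext fun x => (hd x).deriv]
  have hFcont := hF.continuous
  refine (h0.add h1).mono' (Continuous.aestronglyMeasurable (by fun_prop))
    (Eventually.of_forall fun x => ?_)
  rw [norm_mul, Real.norm_eq_abs, abs_two]
  have := norm_inner_le_norm (𝕜 := ℝ) (F x) (deriv F x)
  simp only [Pi.add_apply]
  nlinarith [sq_nonneg (‖F x‖ - ‖deriv F x‖)]

/-! ## The matrix elements -/

theorem matrixElement_eq_integral (C : OneParticle) {g : ℝ → ℝ}
    (hg : ∀ᵐ x ∂halfLine, ‖C x‖ ^ 2 = g x) (n : ℕ) (t : ℝ) :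
    matrixElement C n t = ∫ w, (∏ j, g (w j)) • evolutionSymbol C t (∑ j, w j) ∂modeMeasure n := by
  rw [matrixElement, Submodule.coe_inner, L2.inner_def]
  refine integral_congr_ae ?_
  have h1 := (memLp_tensorPower C n).coeFn_toLp
  have h2 := (memLp_of_mem_functionDomain
    ⟨tensorPower C n, mem_domain_evolution C t n (tensorPower C n)⟩).coeFn_toLp
  have h3 : ∀ᵐ w ∂modeMeasure n, ∀ j, ‖C (w j)‖ ^ 2 = g (w j) := ae_all_iff.2 fun j =>
    (Measure.quasiMeasurePreserving_eval (fun _ : Fin n => halfLine) j).ae hg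
  filter_upwards [h1, h2, h3] with w hw1 hw2 hw3
  change inner ℂ (((memLp_tensorPower C n).toLp _ : TensorSpace n) w)
    (((memLp_of_mem_functionDomain
      ⟨tensorPower C n, mem_domain_evolution C t n (tensorPower C n)⟩).toLp _ : TensorSpace n) w) = _
  rw [hw2]
  change inner ℂ (((memLp_tensorPower C n).toLp _ : TensorSpace n) w)
    (evolutionSymbol C t (∑ j, w j) * ((memLp_tensorPower C n).toLp _ : TensorSpace n) w) = _
  have hp : (∏ j, ‖C (w j)‖) ^ 2 = ∏ j, g (w j) := by
    rw [← Finset.prod_pow, Finset.prod_congr rfl fun j _ => hw3 j]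
  rw [hw1, RCLike.inner_apply, mul_assoc, RCLike.mul_conj, norm_prod, ← RCLike.ofReal_pow, hp,
    Complex.real_smul, mul_comm]
  rfl

/-- The measure is a unit point mass, and the phase vanishes at `0` because `E(0) = 0`. -/
theorem matrixElement_zero (C : OneParticle) (t : ℝ) : matrixElement C 0 t = 1 := by
  rw [matrixElement_eq_integral C (g := fun x => ‖C x‖ ^ 2) (Eventually.of_forall fun _ => rfl)]
  simp [evolutionSymbol, phase, energyFunction, modeMeasure, Measure.pi_of_empty _ 0]

theorem matrixElement_succ (C : OneParticle) {g : ℝ → ℝ} (hgi : IntegrableOn g (Ioi 0))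
    (hg : ∀ᵐ x ∂halfLine, ‖C x‖ ^ 2 = g x) (m : ℕ) (t : ℝ) :
    matrixElement C (m + 1) t = ∫ z in Ioi 0,
      Complex.exp (Complex.I * (t * phase C z : ℝ)) * (iteratedConv g m z : ℂ) := by
  have hm : Measurable (evolutionSymbol C t) := by
    unfold evolutionSymbol phase energyFunction
    fun_prop
  rw [matrixElement_eq_integral C hg, (integral_prod_smul_sum_eq hgi m hm.stronglyMeasurable
    (M := 1) fun z => by rw [evolutionSymbol, Complex.norm_exp_I_mul_ofReal]).2]
  simp only [evolutionSymbol, Complex.real_smul, mul_comm]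

/-! ## The phase -/

theorem hasDerivAt_phase (C : OneParticle) (z : ℝ) :
    HasDerivAt (phase C) (Real.exp (-freeEnergy C / 2) - Real.exp (-z / 2)) z := by
  unfold phase energyFunction
  have h1 : HasDerivAt (fun z : ℝ => -z / 2) (-1 / 2) z := (hasDerivAt_id z).neg.div_const 2
  refine (((hasDerivAt_id z).const_mul _).sub ((h1.exp.const_mul 2).const_sub 2)).congr_deriv ?_
  ring

theorem hasDerivAt_deriv_phase (C : OneParticle) (z : ℝ) :
    HasDerivAt (fun z => Real.exp (-freeEnergy C / 2) - Real.exp (-z / 2))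
      (Real.exp (-z / 2) / 2) z := by
  have h1 : HasDerivAt (fun z : ℝ => -z / 2) (-1 / 2) z := (hasDerivAt_id z).neg.div_const 2
  refine (h1.exp.const_sub _).congr_deriv ?_
  ring

theorem deriv_phase_eq_zero_iff (C : OneParticle) (z : ℝ) :
    deriv (phase C) z = 0 ↔ z = freeEnergy C := by
  rw [(hasDerivAt_phase C z).deriv, sub_eq_zero, Real.exp_eq_exp]
  constructor <;> intro h <;> linarith

theorem phase_freeEnergy (C : OneParticle) : phase C (freeEnergy C) = varrho C := by
  rw [phase, energyFunction, varrho]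
  ring

/-- A nonnegative integrable function with zero integral vanishes a.e., and the weight `w` is
positive. Integrability excludes the default value `0` of a divergent integral. -/
theorem freeEnergy_pos (C : OneParticle) (hi : IntegrableOn (fun w => w * ‖C w‖ ^ 2) (Ioi 0))
    (hC : C ≠ 0) : 0 < freeEnergy C := by
  have h0 : 0 ≤ᵐ[halfLine] fun w => w * ‖C w‖ ^ 2 :=
    (ae_restrict_mem measurableSet_Ioi).mono fun w hw =>
      mul_nonneg (le_of_lt hw) (sq_nonneg _)
  refine (integral_nonneg_of_ae h0).lt_of_ne' fun h => hC ?_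
  rw [integral_eq_zero_iff_of_nonneg_ae h0 hi] at h
  refine Lp.ext ?_
  filter_upwards [h, Lp.coeFn_zero ℂ 2 halfLine, ae_restrict_mem measurableSet_Ioi]
    with w hw hw0 hwpos
  rw [hw0]
  simpa [(mem_Ioi.1 hwpos).ne'] using hw

/-- The stationary phase expansion of the oscillatory integrals with the phase of the evolution. -/
theorem isBigO_integral_phase_sub (C : OneParticle) (hC : 0 < freeEnergy C) {G : ℝ → ℝ}
    (hG : SmoothDensity G) :
    (fun t : ℝ => (∫ z in Ioi 0, Complex.exp (Complex.I * (t * phase C z : ℝ)) * (G z : ℂ)) -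
      (Real.sqrt (4 * Real.pi) * Real.exp (freeEnergy C / 4) * G (freeEnergy C) : ℝ) *
        Complex.exp (Complex.I * (Real.pi / 4 : ℝ)) *
          (Complex.exp (Complex.I * (t * varrho C : ℝ)) / (Real.sqrt t : ℂ)))
      =O[atTop] fun t : ℝ => 1 / t := by
  set h := freeEnergy C with hh
  have hφ2 : ContDiff ℝ 3 fun z : ℝ => Real.exp (-z / 2) / 2 := by fun_prop
  have hGd : ∀ z, HasDerivAt G (deriv G z) z := fun z =>
    (hG.contDiff.differentiable two_ne_zero z).hasDerivAt
  have hsub : Ioi (h + 1) ⊆ Ioi 0 := Ioi_subset_Ioi (by linarith)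
  obtain ⟨M1, hM1⟩ := exists_norm_stationaryPhase_sub_le (hasDerivAt_phase C)
    (hasDerivAt_deriv_phase C) hφ2 (fun z => by positivity) (h := h) (by rw [hh, sub_self]) hC
    (lt_add_one h) hG.contDiff
  -- `φ'` increases and `φ''` decreases, so their values at `h + 1` provide `δ` and `M`.
  obtain ⟨M2, hM2⟩ := exists_norm_integral_Ioi_oscillation_le (b := h + 1)
    (δ := Real.exp (-h / 2) - Real.exp (-(h + 1) / 2)) (M := Real.exp (-(h + 1) / 2) / 2)
    (hasDerivAt_phase C) (hasDerivAt_deriv_phase C) hφ2.continuous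
    (sub_pos.2 (Real.exp_lt_exp.2 (by linarith)))
    (fun z hz => sub_le_sub_left (Real.exp_le_exp.2 (by linarith)) _)
    (fun z hz => by
      rw [abs_of_pos (by positivity)]
      have := Real.exp_le_exp.2 (show -z / 2 ≤ -(h + 1) / 2 by linarith)
      linarith) hGd (hG.contDiff.continuous_deriv one_le_two)
    (hG.integrableOn.mono_set hsub) (hG.integrableOn_deriv.mono_set hsub)
  have hcoef : G h * Real.sqrt (2 * Real.pi / (Real.exp (-h / 2) / 2)) =
      Real.sqrt (4 * Real.pi) * Real.exp (h / 4) * G h := by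
    have h1 : 2 * Real.pi / (Real.exp (-h / 2) / 2) = 4 * Real.pi * Real.exp (h / 2) := by
      rw [neg_div, Real.exp_neg]
      field_simp
      norm_num
    rw [h1, Real.sqrt_mul (by positivity), ← Real.exp_half, mul_comm]
    ring_nf
  have hpc : Continuous (phase C) :=
    continuous_iff_continuousAt.2 fun z => (hasDerivAt_phase C z).continuousAt
  refine IsBigO.of_bound (M1 + M2) ((eventually_gt_atTop 0).mono fun t ht => ?_)
  have hi : IntegrableOn (fun z => Complex.exp (Complex.I * (t * phase C z : ℝ)) * (G z : ℂ))
      (Ioi 0) := by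
    refine (hG.integrableOn.ofReal (𝕜 := ℂ)).bdd_mul (c := 1)
      (Continuous.aestronglyMeasurable (by fun_prop)) (Eventually.of_forall fun z => ?_)
    rw [Complex.norm_exp_I_mul_ofReal]
  have h1 := hM1 t ht
  rw [hcoef, hh, phase_freeEnergy, ← hh] at h1
  rw [← intervalIntegral.integral_interval_add_Ioi hi (hi.mono_set hsub), add_sub_right_comm,
    Real.norm_of_nonneg (one_div_nonneg.2 ht.le), mul_one_div, add_div]
  exact (norm_add_le _ _).trans (add_le_add h1 (hM2 t ht))

/-! ### The zero state and the sum over particle numbers -/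

theorem iteratedConv_eq_zero {g : ℝ → ℝ} (hg : ∀ z, 0 ≤ z → g z = 0) (m : ℕ) {z : ℝ}
    (hz : 0 ≤ z) : iteratedConv g m z = 0 := by
  cases m with
  | zero => exact hg z hz
  | succ m =>
    refine intervalIntegral.integral_zero_ae (Eventually.of_forall fun y hy => ?_)
    rw [uIoc_of_le hz] at hy
    rw [hg y hy.1.le, zero_mul]

/-- Continuity upgrades a.e. vanishing to vanishing on the open half line, and then at its endpoint
`0`. -/
theorem eq_zero_of_mode_eq_zero {g : ℝ → ℝ} (hg : Continuous g)
    (h : ∀ᵐ x ∂halfLine, ‖(0 : OneParticle) x‖ ^ 2 = g x) {z : ℝ} (hz : 0 ≤ z) : g z = 0 := by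
  have h1 : g =ᵐ[volume.restrict (Ioi 0)] fun _ => 0 := by
    filter_upwards [h, Lp.coeFn_zero ℂ 2 halfLine] with x hx hx0
    rw [← hx, hx0]
    simp
  have h2 := (Measure.eqOn_open_of_ae_eq h1 isOpen_Ioi hg.continuousOn
    continuousOn_const).closure hg continuous_const
  rw [closure_Ioi] at h2
  exact h2 hz

/-- The sum over `n` is finite, so the errors add; the term `n = 0` is exact and supplies the
constant. -/
theorem isBigO_truncatedProjection_sub (C : OneParticle) (c : ℝ → ℂ)
    (h : ∀ n : ℕ, 1 ≤ n → (fun t : ℝ => matrixElement C n t -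
          stationaryCoefficient C c n *
            (Complex.exp (Complex.I * (t * varrho C : ℝ)) / (Real.sqrt t : ℂ)))
        =O[atTop] fun t : ℝ => 1 / t) (N : ℕ) :
    (fun t : ℝ => truncatedProjection C N t -
          ((Real.exp (-‖C‖ ^ 2) : ℂ) +
            Complex.exp (Complex.I * (t * varrho C : ℝ)) / (Real.sqrt t : ℂ) * amplitude C c N))
        =O[atTop] fun t : ℝ => 1 / t := by
  have hsum : (fun t : ℝ => (Real.exp (-‖C‖ ^ 2) : ℂ) * ∑ n ∈ Finset.Icc 1 N,
      (1 / (n.factorial : ℂ)) * (matrixElement C n t - stationaryCoefficient C c n *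
        (Complex.exp (Complex.I * (t * varrho C : ℝ)) / (Real.sqrt t : ℂ))))
      =O[atTop] fun t : ℝ => 1 / t :=
    (IsBigO.fun_sum fun n hn => (h n (Finset.mem_Icc.1 hn).1).const_mul_left _).const_mul_left _
  refine hsum.congr_left fun t => ?_
  have hI : Finset.Ico 1 (N + 1) = Finset.Icc 1 N := by
    ext n
    simp
  rw [truncatedProjection, amplitude, Finset.range_eq_Ico, Finset.sum_eq_sum_Ico_succ_bot (by simp),
    matrixElement_zero, zero_add, hI]
  have hsub : ∀ a : ℂ, ∑ n ∈ Finset.Icc 1 N, (1 / (n.factorial : ℂ)) *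
      (matrixElement C n t - stationaryCoefficient C c n * a) =
      ∑ n ∈ Finset.Icc 1 N, (1 / (n.factorial : ℂ)) * matrixElement C n t -
        a * ∑ n ∈ Finset.Icc 1 N, (1 / (n.factorial : ℂ)) * stationaryCoefficient C c n := by
    intro a
    rw [Finset.mul_sum, ← Finset.sum_sub_distrib]
    exact Finset.sum_congr rfl fun n _ => by ring
  rw [hsub, Nat.factorial_zero, Nat.cast_one]
  ring

end EinsteinRosen

open EinsteinRosen in
theorem proposition3 (C : OneParticle) (c : ℝ → ℂ)
    (hCc : C =ᵐ[halfLine] c) (hc : RegularModes c) :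
    -- the phase has exactly one stationary point, `z = h₀(C)`, interior if `C ≠ 0`, of value `ϱ(C)`
    (∀ z, deriv (phase C) z = 0 ↔ z = freeEnergy C) ∧
    (C ≠ 0 → 0 < freeEnergy C) ∧
    phase C (freeEnergy C) = varrho C ∧
    -- the matrix elements as oscillatory integrals and their expansions
    (∀ n : ℕ, 1 ≤ n →
      IntegrableOn (energyDensity c n) (Ioi 0) ∧
      (∀ t : ℝ, matrixElement C n t =
        ∫ z in Ioi 0, Complex.exp (Complex.I * (t * phase C z : ℝ)) * energyDensity c n z) ∧
      (fun t : ℝ => matrixElement C n t -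
          stationaryCoefficient C c n *
            (Complex.exp (Complex.I * (t * varrho C : ℝ)) / (Real.sqrt t : ℂ)))
        =O[atTop] fun t : ℝ => 1 / t) ∧
    -- the expansion of the truncated projection
    (∀ N : ℕ,
      (fun t : ℝ => truncatedProjection C N t -
          ((Real.exp (-‖C‖ ^ 2) : ℂ) +
            Complex.exp (Complex.I * (t * varrho C : ℝ)) / (Real.sqrt t : ℂ) * amplitude C c N))
        =O[atTop] fun t : ℝ => 1 / t) := by
  obtain ⟨F, hF, hFc⟩ := exists_contDiff_eqOn_Ici 2 hc.contDiffOn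
  set g : ℝ → ℝ := fun x => ‖F x‖ ^ 2 with hgdef
  have hg : SmoothDensity g := smoothDensity_norm_sq hc hF hFc
  have hcg : ∀ x, 0 ≤ x → ‖c x‖ ^ 2 = g x := fun x hx => by rw [hgdef, ← hFc (mem_Ici.2 hx)]
  have hCg : ∀ᵐ x ∂halfLine, ‖C x‖ ^ 2 = g x := by
    filter_upwards [hCc, ae_restrict_mem measurableSet_Ioi] with x hx hx0
    rw [hx, hcg x (le_of_lt hx0)]
  have hpos : C ≠ 0 → 0 < freeEnergy C := freeEnergy_pos C (hc.energy.congr_fun_ae (by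
    filter_upwards [hCc] with x hx
    rw [hx]))
  have hdens : ∀ (m : ℕ) (z : ℝ), 0 ≤ z → energyDensity c (m + 1) z = iteratedConv g m z :=
    fun m z hz => energyDensity_succ hg.contDiff.continuous hg.integrableOn hcg m hz
  have hint : ∀ (m : ℕ) (t : ℝ), matrixElement C (m + 1) t =
      ∫ z in Ioi 0, Complex.exp (Complex.I * (t * phase C z : ℝ)) * (iteratedConv g m z : ℂ) :=
    matrixElement_succ C hg.integrableOn hCg
  have h0 : 0 ≤ freeEnergy C :=
    setIntegral_nonneg measurableSet_Ioi fun w hw => mul_nonneg (le_of_lt hw) (sq_nonneg _)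
  have hexp : ∀ n : ℕ, 1 ≤ n → (fun t : ℝ => matrixElement C n t -
      stationaryCoefficient C c n *
        (Complex.exp (Complex.I * (t * varrho C : ℝ)) / (Real.sqrt t : ℂ)))
      =O[atTop] fun t : ℝ => 1 / t := by
    intro n hn
    obtain ⟨m, rfl⟩ := Nat.exists_eq_add_of_le' hn
    simp only [stationaryCoefficient, hint, hdens m _ h0]
    -- For `C = 0` the stationary point sits at the endpoint `0`, outside the scope of the
    -- expansion, but both the integral and its coefficient vanish.
    by_cases hC : C = 0
    · subst hC
      have hz : ∀ z, 0 ≤ z → iteratedConv g m z = 0 := fun z hz =>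
        iteratedConv_eq_zero (fun z hz => eq_zero_of_mode_eq_zero hg.contDiff.continuous hCg hz) m hz
      refine (isBigO_zero _ _).congr_left fun t => ?_
      rw [hz _ h0, setIntegral_congr_fun (g := fun _ => (0 : ℂ)) measurableSet_Ioi fun z hz' => by
        simp [hz z (le_of_lt hz')]]
      simp
    · exact isBigO_integral_phase_sub C (hpos hC) (hg.iteratedConv m)
  refine ⟨deriv_phase_eq_zero_iff C, hpos, phase_freeEnergy C, fun n hn => ⟨?_, fun t => ?_,
    hexp n hn⟩, isBigO_truncatedProjection_sub C c hexp⟩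
  · obtain ⟨m, rfl⟩ := Nat.exists_eq_add_of_le' hn
    exact (hg.iteratedConv m).integrableOn.congr_fun
      (fun z hz => (hdens m z (le_of_lt hz)).symm) measurableSet_Ioi
  · obtain ⟨m, rfl⟩ := Nat.exists_eq_add_of_le' hn
    rw [hint]
    exact setIntegral_congr_fun measurableSet_Ioi fun z hz => by
      simp only [hdens m z (le_of_lt hz)]
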